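/- **Setting.** Let $m,p,q_1,\dots,q_m\in\mathbb N$ and consider the multi-participant ARX system $$y_{k+1}=\sum_{j=1}^{p}a_j y_{k+1-j}+\sum_{i=1}^{m}\sum_{l=1}^{q_i}b_{i,l}u_{i,k+1-l}+\omega_{k+1},\qquad k\ge 0,$$ with all outputs at times $\le 0$ and all inputs at negative times equal to zero, unknown parameter $\theta=[a_1,\dots,a_p,b_{1,1},\dots,b_{1,q_1},\dots,b_{m,1},\dots,b_{m,q_m}]^T$ and regression vector $\varphi_k=[y_k,\dots,y_{k+1-p},u_{1,k},\dots,u_{1,k+1-q_1},\dots,u_{m,k},\dots,u_{m,k+1-q_m}]^T$, so that $y_{k+1}=\theta^T\varphi_k+\omega_{k+1}$. Participant $\mathcal P_0$ publishes $\bar y_k=y_k+\eta_k$ ($k\ge1$; $\bar y_k=0$ for $k\le 0$), where each $\eta_k$ has the Laplace distribution with density $\frac1{2b_0}e^{-|x|/b_0}$, $b_0>0$; Participant $\mathcal P_i$, $1\le i\le m$, publishes $\bar u_{i,k}=u_{i,k}+\xi_{i,k}$ ($k\ge 0$; $\bar u_{i,k}=0$ for $k<0$). Let $\bar\varphi_k$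 be $\varphi_k$ with $y,u$ replaced by $\bar y,\bar u$. From $\bar P_0=\alpha^{-1}I$ with $\alpha>0$ and any deterministic $\theta_0$, the recursive least-squares algorithm computes $$\bar a_k=(1+\bar\varphi_k^T\bar P_k\bar\varphi_k)^{-1},\quad \theta_{k+1}=\theta_k+\bar a_k\bar P_k\bar\varphi_k(\bar y_{k+1}-\bar\varphi_k^T\theta_k),\quad \bar P_{k+1}=\bar P_k-\bar a_k\bar P_k\bar\varphi_k\bar\varphi_k^T\bar P_k .$$ Let $r_k=e+\sum_{t=0}^k\|\bar\varphi_t\|^2$, and let $\lambda_{\min}$ denote the smallest eigenvalue. **Theorem.** Let $\varepsilon,\delta>0$. Suppose that $p=0$, that $\xi_{i,k}=0$ for all $i=1,\dots,m$ and $k\ge0$, and that: 1. (stability) $1-a_1z-\dots-a_pz^p\ne0$ for all complex $|z|\le1$ (void for $p=0$); 2. (privacy noise) the $\eta_{k+1}$ and $\xi_{i,k}$ ($k\ge0$, $1\le i\le m$) are mutually independent and are jointly independent of the processes $\{y_k\},\{u_{i,k}\},\{\omega_k\}$ taken together; 3. (system noise) $\{\omega_k,\mathscr F_k\}$ is a martingale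 difference sequence for a filtration $\{\mathscr F_k\}$, and for some $\beta\ge2$, $\sup_kE(|\omega_{k+1}|^\beta\mid\mathscr F_k)<\infty$ a.s.; 4. (adaptedness) $\varphi_k$ is $\mathscr F_k$-measurable for all $k\ge0$; 5. (noise scale) $\frac{C_1}{b_0}\delta\le\varepsilon$, where $C_1=1+\frac{\sqrt p\,c_0\lambda}{1-\lambda}$ and $c_0\ge0$, $\lambda\in(0,1)$ satisfy $\|A^k\|\le c_0\lambda^k$ for all $k\in\mathbb N$, with $A$ the $p\times p$ companion matrix having ones on the superdiagonal, last row $(a_p,\dots,a_1)$ and zeros elsewhere (so $C_1=1$ for $p=0$); 6. (excitation) for some $\kappa>1$, almost surely as $k\to\infty$, $$\frac{\ln r_{k-1}\,(\ln(e+\ln r_{k-1}))^{\kappa}}{\lambda_{\min}(\bar P_k^{-1})}\to0\ \text{ if }\beta=2,\qquad \frac{\ln r_{k-1}}{\lambda_{\min}(\bar P_k^{-1})}\to0\ \text{ if }\beta>2;$$ 7. $\lambda_{\min}(\bar P_k^{-1})\to\infty$ almost surely. Then: i. The algorithm is $\varepsilon$-differentially private under $\delta$-adjacency for Participant $\mathcal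 P_0$: for all $T_2\ge T_1\ge1$, all $x,x'\in\mathbb R^{T_1}$ with $\|x-x'\|_1\le\delta$ and all Borel $D\subseteq\mathbb R^{T_2}$, $$\mathbb P(\mathcal M(x)\in D)\le e^{\varepsilon}\,\mathbb P(\mathcal M(x')\in D),$$ where $\mathcal M(x)=(\bar y_1,\dots,\bar y_{T_2})$ is the vector of published outputs when $(y_1,\dots,y_{T_1})=x$ is prescribed and $y_{T_1+1},\dots,y_{T_2}$ are generated by the system equation from $x$, the inputs and the system noise. ii. $\theta_k\to\theta$ almost surely. -/

import Mathlib

open MeasureTheory ProbabilityTheory Filter Topology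
open scoped ENNReal Matrix

noncomputable section

namespace MPARX

/-! ### The multi-participant ARX system

`m` participants provide inputs, `p` is the autoregressive order and `q i` is the order of the
`i`-th input. Paths are indexed by `ℕ`; values at negative times are zero. -/

/-- Coordinates of the parameter vector: `p` autoregressive ones, then `q i` for each input. -/
abbrev Idx (p : ℕ) {m : ℕ} (q : Fin m → ℕ) : Type :=
  Fin p ⊕ (Σ i : Fin m, Fin (q i))

/-- The value `x_{k - j}`, with the convention that values at negative times are zero. -/
def lag (x : ℕ → ℝ) (k j : ℕ) : ℝ := if j ≤ k then x (k - j) else 0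

variable {p m : ℕ} {q : Fin m → ℕ}

/-- `θ = [a_1, …, a_p, b_{1,1}, …, b_{1,q_1}, …, b_{m,1}, …, b_{m,q_m}]ᵀ`
(`a j` stands for `a_{j+1}` and `b i l` for `b_{i,l+1}`). -/
def paramVec (a : Fin p → ℝ) (b : ∀ i : Fin m, Fin (q i) → ℝ) : Idx p q → ℝ :=
  Sum.elim a (fun s => b s.1 s.2)

/-- The regression vector
`[y_k, …, y_{k+1-p}, u_{1,k}, …, u_{1,k+1-q_1}, …, u_{m,k}, …, u_{m,k+1-q_m}]ᵀ`. -/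
def regressor (p : ℕ) (q : Fin m → ℕ) (y : ℕ → ℝ) (u : Fin m → ℕ → ℝ) (k : ℕ) : Idx p q → ℝ :=
  Sum.elim (fun j => lag y k j) (fun s => lag (u s.1) k s.2)

/-- The output path whose first `T` values `y_1, …, y_T` are prescribed to be `x` and whose
subsequent values are generated by the system equation
`y_{k+1} = ∑ j, a_j y_{k+1-j} + ∑ i, ∑ l, b_{i,l} u_{i,k+1-l} + w_{k+1}`; `y_k = 0` for `k ≤ 0`. -/
def outputFrom (a : Fin p → ℝ) (b : ∀ i : Fin m, Fin (q i) → ℝ)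
    (u : Fin m → ℕ → ℝ) (w : ℕ → ℝ) {T : ℕ} (x : Fin T → ℝ) : ℕ → ℝ
  | 0 => 0
  | k + 1 =>
    if h : k < T then x ⟨k, h⟩
    else (∑ j : Fin p, a j * (if (j : ℕ) ≤ k then outputFrom a b u w x (k - j) else 0))
      + (∑ i : Fin m, ∑ l : Fin (q i), b i l * lag (u i) k l) + w (k + 1)
  termination_by k => k
  decreasing_by omega

/-- The output of the system: nothing is prescribed, the system equation holds at all `k ≥ 0`. -/
def output (a : Fin p → ℝ) (b : ∀ i : Fin m, Fin (q i) → ℝ)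
    (u : Fin m → ℕ → ℝ) (w : ℕ → ℝ) : ℕ → ℝ :=
  outputFrom a b u w (T := 0) Fin.elim0

/-- Asymptotic stability: `1 - a_1 z - ⋯ - a_p z^p ≠ 0` for all complex `|z| ≤ 1`. -/
def AsymptoticallyStable (a : Fin p → ℝ) : Prop :=
  ∀ z : ℂ, ‖z‖ ≤ 1 → 1 - ∑ j : Fin p, (a j : ℂ) * z ^ ((j : ℕ) + 1) ≠ 0

/-- The companion matrix: ones above the diagonal, last row `a_p, a_{p-1}, …, a_1`. -/
def companion (a : Fin p → ℝ) : Matrix (Fin p) (Fin p) ℝ :=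
  fun i j =>
    if (i : ℕ) + 1 = p then a j.rev
    else if (j : ℕ) = (i : ℕ) + 1 then 1 else 0

/-- `‖A ^ k‖ ≤ c₀ λ ^ k` for all `k`, in the operator norm of the Euclidean norm, where `A` is the
companion matrix and `0 < λ < 1`. -/
def DecayBound (a : Fin p → ℝ) (c₀ lam : ℝ) : Prop :=
  0 ≤ c₀ ∧ 0 < lam ∧ lam < 1 ∧
    ∀ k : ℕ, ‖Matrix.toEuclideanCLM (𝕜 := ℝ) (companion a ^ k)‖ ≤ c₀ * lam ^ k

/-- The constant `C₁ = 1 + √p c₀ λ / (1 - λ)`. -/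
def privacyConst (p : ℕ) (c₀ lam : ℝ) : ℝ := 1 + √(p : ℝ) * c₀ * lam / (1 - lam)

/-! ### The algorithm -/

/-- The message `ȳ_k = y_k + η_k` for `k ≥ 1`, and `0` at time `0`. -/
def perturbedOutput (y η : ℕ → ℝ) : ℕ → ℝ
  | 0 => 0
  | k + 1 => y (k + 1) + η (k + 1)

/-- The message `ū_{i,k} = u_{i,k} + ξ_{i,k}`. -/
def perturbedInput (u ξ : Fin m → ℕ → ℝ) : Fin m → ℕ → ℝ := fun i k => u i k + ξ i k

/-- The state `(θ_k, P̄_k)` of recursive least squares run on the messages `yb`, `ub`: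
`P̄_0 = α⁻¹ I`, `ā_k = (1 + φ̄_kᵀ P̄_k φ̄_k)⁻¹`,
`θ_{k+1} = θ_k + ā_k P̄_k φ̄_k (ȳ_{k+1} - φ̄_kᵀ θ_k)` and
`P̄_{k+1} = P̄_k - ā_k P̄_k φ̄_k φ̄_kᵀ P̄_k`. -/
def rlsState (α : ℝ) (θ₀ : Idx p q → ℝ) (yb : ℕ → ℝ) (ub : Fin m → ℕ → ℝ) :
    ℕ → (Idx p q → ℝ) × Matrix (Idx p q) (Idx p q) ℝ
  | 0 => (θ₀, α⁻¹ • (1 : Matrix (Idx p q) (Idx p q) ℝ))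
  | k + 1 =>
    let θ := (rlsState α θ₀ yb ub k).1
    let P := (rlsState α θ₀ yb ub k).2
    let φ := regressor p q yb ub k
    let g := (1 + φ ⬝ᵥ (P *ᵥ φ))⁻¹
    (θ + (g * (yb (k + 1) - φ ⬝ᵥ θ)) • (P *ᵥ φ),
      P - g • (P * Matrix.vecMulVec φ φ * P))

/-- The estimate `θ_k`. -/
def estimate (α : ℝ) (θ₀ : Idx p q → ℝ) (yb : ℕ → ℝ) (ub : Fin m → ℕ → ℝ) (k : ℕ) : Idx p q → ℝ :=
  (rlsState α θ₀ yb ub k).1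

/-- The inverse `P̄_k⁻¹` of the gain matrix. -/
def gainInv (α : ℝ) (θ₀ : Idx p q → ℝ) (yb : ℕ → ℝ) (ub : Fin m → ℕ → ℝ) (k : ℕ) :
    Matrix (Idx p q) (Idx p q) ℝ :=
  (rlsState α θ₀ yb ub k).2⁻¹

/-- The smallest real eigenvalue of a matrix. -/
def lambdaMin {ι : Type*} [Fintype ι] [DecidableEq ι] (M : Matrix ι ι ℝ) : ℝ :=
  sInf {μ : ℝ | Module.End.HasEigenvalue (Matrix.toLin' M) μ}

/-- `r_k = e + ∑_{t=0}^{k} ‖φ̄_t‖²`. -/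
def energy (p : ℕ) (q : Fin m → ℕ) (yb : ℕ → ℝ) (ub : Fin m → ℕ → ℝ) (k : ℕ) : ℝ :=
  Real.exp 1 + ∑ t ∈ Finset.range (k + 1), regressor p q yb ub t ⬝ᵥ regressor p q yb ub t

/-- `ln r (ln (e + ln r))^κ` if `β = 2`, and `ln r` otherwise (that is, if `β > 2`). -/
def excitationRate (β κ r : ℝ) : ℝ :=
  if β = 2 then Real.log r * (Real.log (Real.exp 1 + Real.log r)) ^ κ else Real.log r

/-! ### Noises and probabilistic assumptions -/

/-- The Laplace distribution `L(μ, b)`, with density `(2b)⁻¹ exp (-|x - μ| / b)`. -/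
def laplaceMeasure (μ b : ℝ) : Measure ℝ :=
  volume.withDensity (fun x => ENNReal.ofReal (1 / (2 * b) * Real.exp (-|x - μ| / b)))

variable {Ω : Type*} [mΩ : MeasurableSpace Ω]

/-- The privacy noises as one family: `none` is `k ↦ η_{k+1}` and `some i` is `k ↦ ξ_{i,k}`. -/
def noiseFamily (η : ℕ → Ω → ℝ) (ξ : Fin m → ℕ → Ω → ℝ) : Option (Fin m) × ℕ → Ω → ℝ
  | (none, k) => η (k + 1)
  | (some i, k) => ξ i k

/-- All `η_{k+1}` and `ξ_{i,k}` are mutually independent, and they are jointly independent of the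
processes `(y_k)`, `(u_{i,k})`, `(w_k)` taken together. -/
def NoiseIndependence (P : Measure Ω) (y : ℕ → Ω → ℝ) (u : Fin m → ℕ → Ω → ℝ) (w : ℕ → Ω → ℝ)
    (η : ℕ → Ω → ℝ) (ξ : Fin m → ℕ → Ω → ℝ) : Prop :=
  iIndepFun (noiseFamily η ξ) P ∧
  IndepFun (fun ω s => noiseFamily η ξ s ω)
    (fun ω => ((fun k => y (k + 1) ω), (fun i k => u i k ω), (fun k => w (k + 1) ω)) :
      Ω → (ℕ → ℝ) × (Fin m → ℕ → ℝ) × (ℕ → ℝ)) P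

/-- `(w_k, ℱ_k)` is a martingale difference sequence, and
`sup_k E[|w_{k+1}|^β | ℱ_k] < ∞` almost surely. -/
def MartingaleNoise (P : Measure Ω) (ℱ : Filtration ℕ mΩ) (w : ℕ → Ω → ℝ) (β : ℝ) : Prop :=
  (∀ k, Measurable[ℱ (k + 1)] (w (k + 1))) ∧
  (∀ k, Integrable (w (k + 1)) P) ∧
  (∀ k, P[w (k + 1) | ℱ k] =ᵐ[P] 0) ∧
  ∀ᵐ ω ∂P, (⨆ k, condLExp (ℱ k) P (fun ω' => ENNReal.ofReal (|w (k + 1) ω'| ^ β)) ω) < ∞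

/-! ### Differential privacy -/

/-- `ε`-differential privacy under `δ`-adjacency with respect to the distance `dist`, of a random
mechanism `M` defined on the probability space `(Ω, P)`. -/
def IsDifferentiallyPrivate {X Y : Type*} [MeasurableSpace Y] (P : Measure Ω)
    (dist : X → X → ℝ) (M : X → Ω → Y) (ε δ : ℝ) : Prop :=
  ∀ x x' : X, dist x x' ≤ δ → ∀ D : Set Y, MeasurableSet D →
    P {ω | M x ω ∈ D} ≤ ENNReal.ofReal (Real.exp ε) * P {ω | M x' ω ∈ D}

/-- The distance of the norm `‖x‖₁ = ∑ |x_i|`. -/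
def l1Dist {n : ℕ} (x x' : Fin n → ℝ) : ℝ := ∑ i, |x i - x' i|

/-- The mechanism of the participant who holds the outputs. It maps the sensitive record
`y_{[1:T₁]} = x` to the observed messages `ȳ_{[1:T₂]}`; the outputs after time `T₁` are generated
by the system from `x`, the inputs `u` and the system noise `w`. -/
def outputMechanism (a : Fin p → ℝ) (b : ∀ i : Fin m, Fin (q i) → ℝ)
    (u : Fin m → ℕ → Ω → ℝ) (w η : ℕ → Ω → ℝ) (T₁ T₂ : ℕ) (x : Fin T₁ → ℝ) (ω : Ω) : Fin T₂ → ℝ :=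
  fun k => perturbedOutput
    (outputFrom a b (fun i j => u i j ω) (fun j => w j ω) x) (fun j => η j ω) ((k : ℕ) + 1)

/-- The algorithm is `ε`-differentially private under `δ`-adjacency for the participant who holds
the outputs: for every record length `T₁ ≥ 1` and every attack duration `T₂ ≥ T₁`. -/
def OutputPrivate (P : Measure Ω) (a : Fin p → ℝ) (b : ∀ i : Fin m, Fin (q i) → ℝ)
    (u : Fin m → ℕ → Ω → ℝ) (w η : ℕ → Ω → ℝ) (ε δ : ℝ) : Prop :=
  ∀ T₁ T₂ : ℕ, 1 ≤ T₁ → T₁ ≤ T₂ →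
    IsDifferentiallyPrivate P l1Dist (outputMechanism a b u w η T₁ T₂) ε δ

/-- The output process `y`, as a random path. -/
def yProc (a : Fin p → ℝ) (b : ∀ i : Fin m, Fin (q i) → ℝ)
    (u : Fin m → ℕ → Ω → ℝ) (w : ℕ → Ω → ℝ) (ω : Ω) : ℕ → ℝ :=
  output a b (fun i j => u i j ω) (fun j => w j ω)

/-- The messages `ȳ`, as a random path. -/
def ybProc (a : Fin p → ℝ) (b : ∀ i : Fin m, Fin (q i) → ℝ)
    (u : Fin m → ℕ → Ω → ℝ) (w η : ℕ → Ω → ℝ) (ω : Ω) : ℕ → ℝ :=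
  perturbedOutput (yProc a b u w ω) (fun j => η j ω)

/-- The messages `ū`, as a random path. -/
def ubProc (u ξ : Fin m → ℕ → Ω → ℝ) (ω : Ω) : Fin m → ℕ → ℝ :=
  perturbedInput (fun i j => u i j ω) (fun i j => ξ i j ω)

end MPARX

end

set_option linter.unusedSectionVars false

namespace LeastSquares

variable {ι : Type*} [Fintype ι] [DecidableEq ι]

/-- The information matrix `α I + ∑_{t<k} x_t x_tᵀ` of regularized least squares. -/
noncomputable def infoMatrix (α : ℝ) (x : ℕ → ι → ℝ) (k : ℕ) : Matrix ι ι ℝ :=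
  α • (1 : Matrix ι ι ℝ) + ∑ t ∈ Finset.range k, Matrix.vecMulVec (x t) (x t)

/-- The score `∑_{t<k} v_{t+1} x_t`. -/
noncomputable def score (x : ℕ → ι → ℝ) (v : ℕ → ℝ) (k : ℕ) : ι → ℝ :=
  ∑ t ∈ Finset.range k, v (t + 1) • x t

/-- The squared length of the score in the metric of the inverse information matrix. -/
noncomputable def scoreEnergy (α : ℝ) (x : ℕ → ι → ℝ) (v : ℕ → ℝ) (k : ℕ) : ℝ :=
  score x v k ⬝ᵥ ((infoMatrix α x k)⁻¹ *ᵥ score x v k)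

/-- The leverage `xᵀ P x / (1 + xᵀ P x)`, where `P` is the inverse information matrix. -/
noncomputable def leverage (α : ℝ) (x : ℕ → ι → ℝ) (k : ℕ) : ℝ :=
  (x k ⬝ᵥ ((infoMatrix α x k)⁻¹ *ᵥ x k)) / (1 + x k ⬝ᵥ ((infoMatrix α x k)⁻¹ *ᵥ x k))

/-- The coefficient of the new noise in the linear term of the increment of the score energy. -/
noncomputable def crossGain (α : ℝ) (x : ℕ → ι → ℝ) (v : ℕ → ℝ) (k : ℕ) : ℝ :=
  (x k ⬝ᵥ ((infoMatrix α x k)⁻¹ *ᵥ score x v k)) / (1 + x k ⬝ᵥ ((infoMatrix α x k)⁻¹ *ᵥ x k))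

theorem infoMatrix_succ (α : ℝ) (x : ℕ → ι → ℝ) (k : ℕ) :
    infoMatrix α x (k + 1) = infoMatrix α x k + Matrix.vecMulVec (x k) (x k) := by
  simp [infoMatrix, Finset.sum_range_succ, add_assoc]

theorem score_succ (x : ℕ → ι → ℝ) (v : ℕ → ℝ) (k : ℕ) :
    score x v (k + 1) = score x v k + v (k + 1) • x k := by
  simp [score, Finset.sum_range_succ]

theorem posSemidef_vecMulVec_self (x : ι → ℝ) : (Matrix.vecMulVec x x).PosSemidef := by
  simpa using Matrix.posSemidef_vecMulVec_self_star x

theorem posDef_infoMatrix {α : ℝ} (hα : 0 < α) (x : ℕ → ι → ℝ) (k : ℕ) :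
    (infoMatrix α x k).PosDef := by
  induction k with
  | zero => simpa [infoMatrix] using Matrix.PosDef.one.smul hα
  | succ k ih => rw [infoMatrix_succ]; exact ih.add_posSemidef (posSemidef_vecMulVec_self _)

theorem isUnit_det_infoMatrix {α : ℝ} (hα : 0 < α) (x : ℕ → ι → ℝ) (k : ℕ) :
    IsUnit (infoMatrix α x k).det :=
  (posDef_infoMatrix hα x k).det_pos.ne'.isUnit

theorem quadratic_inv_nonneg {V : Matrix ι ι ℝ} (hV : V.PosDef) (z : ι → ℝ) :
    0 ≤ z ⬝ᵥ (V⁻¹ *ᵥ z) := by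
  simpa using hV.inv.posSemidef.dotProduct_mulVec_nonneg z

theorem dotProduct_mulVec_symm {M : Matrix ι ι ℝ} (hM : M.IsHermitian) (y z : ι → ℝ) :
    y ⬝ᵥ (M *ᵥ z) = z ⬝ᵥ (M *ᵥ y) := by
  have h : Mᵀ = M := by simpa using hM.eq
  rw [Matrix.dotProduct_mulVec, dotProduct_comm, ← Matrix.mulVec_transpose, h]

/-- The Sherman–Morrison formula for a symmetric rank-one update. -/
theorem inv_add_vecMulVec {V : Matrix ι ι ℝ} (hV : V.PosDef) (x : ι → ℝ) :
    (V + Matrix.vecMulVec x x)⁻¹ =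
      V⁻¹ - (1 + x ⬝ᵥ (V⁻¹ *ᵥ x))⁻¹ • (V⁻¹ * Matrix.vecMulVec x x * V⁻¹) := by
  have hu : IsUnit V.det := hV.det_pos.ne'.isUnit
  have hc := quadratic_inv_nonneg hV x
  apply Matrix.inv_eq_right_inv
  have h1 : V * V⁻¹ = 1 := Matrix.mul_nonsing_inv _ hu
  have h2 : Matrix.vecMulVec x x * V⁻¹ * Matrix.vecMulVec x x =
      (x ⬝ᵥ (V⁻¹ *ᵥ x)) • Matrix.vecMulVec x x := by
    rw [Matrix.vecMulVec_mul, Matrix.vecMulVec_mul_vecMulVec, ← Matrix.dotProduct_mulVec,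
      Matrix.vecMulVec_smul]
  set c := x ⬝ᵥ (V⁻¹ *ᵥ x)
  set X := Matrix.vecMulVec x x
  have h3 : V * (V⁻¹ * X * V⁻¹) = X * V⁻¹ := by
    rw [← mul_assoc, ← mul_assoc, h1, one_mul]
  have h4 : X * (V⁻¹ * X * V⁻¹) = c • (X * V⁻¹) := by
    rw [← mul_assoc, ← mul_assoc, h2, Matrix.smul_mul]
  rw [mul_sub, Matrix.mul_smul, add_mul, add_mul, h1, h3, h4]
  have h5 : X * V⁻¹ + c • (X * V⁻¹) = (1 + c) • (X * V⁻¹) := by rw [add_smul, one_smul]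
  rw [h5, smul_smul, inv_mul_cancel₀ (by positivity), one_smul]
  abel

theorem inv_add_vecMulVec_mulVec {V : Matrix ι ι ℝ} (hV : V.PosDef) (x z : ι → ℝ) :
    (V + Matrix.vecMulVec x x)⁻¹ *ᵥ z =
      V⁻¹ *ᵥ z - ((1 + x ⬝ᵥ (V⁻¹ *ᵥ x))⁻¹ * (x ⬝ᵥ (V⁻¹ *ᵥ z))) • (V⁻¹ *ᵥ x) := by
  rw [inv_add_vecMulVec hV, Matrix.sub_mulVec, Matrix.smul_mulVec, mul_smul, ← Matrix.mulVec_mulVec,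
    ← Matrix.mulVec_mulVec, Matrix.vecMulVec_mulVec]
  simp [Matrix.mulVec_smul]

theorem quadratic_inv_add_vecMulVec {V : Matrix ι ι ℝ} (hV : V.PosDef) (x z : ι → ℝ) :
    z ⬝ᵥ ((V + Matrix.vecMulVec x x)⁻¹ *ᵥ z) =
      z ⬝ᵥ (V⁻¹ *ᵥ z) - (1 + x ⬝ᵥ (V⁻¹ *ᵥ x))⁻¹ * (x ⬝ᵥ (V⁻¹ *ᵥ z)) ^ 2 := by
  rw [inv_add_vecMulVec_mulVec hV, dotProduct_sub, dotProduct_smul,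
    dotProduct_mulVec_symm hV.inv.isHermitian z x, smul_eq_mul]
  ring

theorem leverage_nonneg {α : ℝ} (hα : 0 < α) (x : ℕ → ι → ℝ) (k : ℕ) : 0 ≤ leverage α x k := by
  have := quadratic_inv_nonneg (posDef_infoMatrix hα x k) (x k)
  unfold leverage; positivity

theorem leverage_le_one {α : ℝ} (hα : 0 < α) (x : ℕ → ι → ℝ) (k : ℕ) : leverage α x k ≤ 1 := by
  have := quadratic_inv_nonneg (posDef_infoMatrix hα x k) (x k)
  unfold leverage
  rw [div_le_one (by positivity)]; linarith

theorem scoreEnergy_succ_le {α : ℝ} (hα : 0 < α) (x : ℕ → ι → ℝ) (v : ℕ → ℝ) (k : ℕ) :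
    scoreEnergy α x v (k + 1) ≤ scoreEnergy α x v k - crossGain α x v k ^ 2
      + 2 * (crossGain α x v k * v (k + 1)) + leverage α x k * v (k + 1) ^ 2 := by
  have hV := posDef_infoMatrix hα x k
  have hc := quadratic_inv_nonneg hV (x k)
  have hsym := dotProduct_mulVec_symm hV.inv.isHermitian (score x v k) (x k)
  unfold scoreEnergy crossGain leverage
  rw [infoMatrix_succ, score_succ, quadratic_inv_add_vecMulVec hV]
  simp only [Matrix.mulVec_add, Matrix.mulVec_smul, dotProduct_add, add_dotProduct,
    dotProduct_smul, smul_dotProduct, smul_eq_mul, hsym]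
  set c := x k ⬝ᵥ ((infoMatrix α x k)⁻¹ *ᵥ x k)
  set s := x k ⬝ᵥ ((infoMatrix α x k)⁻¹ *ᵥ score x v k)
  set Q := score x v k ⬝ᵥ ((infoMatrix α x k)⁻¹ *ᵥ score x v k)
  set w := v (k + 1)
  have h1 : (1 + c) ≠ 0 := by positivity
  have key : Q - (s / (1 + c)) ^ 2 + 2 * (s / (1 + c) * w) + c / (1 + c) * w ^ 2
      - (Q + w * s + (w * s + w * (w * c)) - (1 + c)⁻¹ * (s + w * c) ^ 2)
      = c * (s / (1 + c)) ^ 2 := by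
    field_simp
    ring
  have : 0 ≤ c * (s / (1 + c)) ^ 2 := by positivity
  linarith

theorem scoreEnergy_le {α : ℝ} (hα : 0 < α) (x : ℕ → ι → ℝ) (v : ℕ → ℝ) (k : ℕ) :
    scoreEnergy α x v k ≤ 2 * ∑ t ∈ Finset.range k, crossGain α x v t * v (t + 1)
      - ∑ t ∈ Finset.range k, crossGain α x v t ^ 2
      + ∑ t ∈ Finset.range k, leverage α x t * v (t + 1) ^ 2 := by
  induction k with
  | zero => simp [scoreEnergy, score]
  | succ k ih =>
    simp only [Finset.sum_range_succ]
    linarith [scoreEnergy_succ_le hα x v k]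

theorem det_infoMatrix_succ {α : ℝ} (hα : 0 < α) (x : ℕ → ι → ℝ) (k : ℕ) :
    (infoMatrix α x (k + 1)).det =
      (infoMatrix α x k).det * (1 + x k ⬝ᵥ ((infoMatrix α x k)⁻¹ *ᵥ x k)) := by
  rw [infoMatrix_succ, Matrix.vecMulVec_eq Unit,
    Matrix.det_add_replicateCol_mul_replicateRow (isUnit_det_infoMatrix hα x k)]
  congr 1
  rw [Matrix.det_unique, Matrix.add_apply, Matrix.one_apply_eq, Matrix.dotProduct_mulVec]
  rfl

theorem sum_leverage_le_log_det {α : ℝ} (hα : 0 < α) (x : ℕ → ι → ℝ) (k : ℕ) :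
    ∑ t ∈ Finset.range k, leverage α x t ≤
      Real.log (infoMatrix α x k).det - Real.log (infoMatrix α x 0).det := by
  induction k with
  | zero => simp
  | succ k ih =>
    have hc := quadratic_inv_nonneg (posDef_infoMatrix hα x k) (x k)
    rw [Finset.sum_range_succ, det_infoMatrix_succ hα,
      Real.log_mul (posDef_infoMatrix hα x k).det_pos.ne' (by positivity)]
    have h1 : leverage α x k = 1 - (1 + x k ⬝ᵥ ((infoMatrix α x k)⁻¹ *ᵥ x k))⁻¹ := by
      unfold leverage; field_simp; ring
    have h2 := Real.one_sub_inv_le_log_of_pos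
      (x := 1 + x k ⬝ᵥ ((infoMatrix α x k)⁻¹ *ᵥ x k)) (by positivity)
    linarith

theorem trace_infoMatrix (α : ℝ) (x : ℕ → ι → ℝ) (k : ℕ) :
    (infoMatrix α x k).trace = α * Fintype.card ι + ∑ t ∈ Finset.range k, x t ⬝ᵥ x t := by
  simp [infoMatrix, Matrix.trace_add, Matrix.trace_smul, Matrix.trace_sum, Matrix.trace_vecMulVec]

theorem det_le_trace_pow {V : Matrix ι ι ℝ} (hV : V.PosDef) :
    V.det ≤ V.trace ^ Fintype.card ι := by
  rw [hV.isHermitian.det_eq_prod_eigenvalues, hV.isHermitian.trace_eq_sum_eigenvalues]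
  simp only [RCLike.ofReal_real_eq_id, id]
  calc ∏ i, hV.isHermitian.eigenvalues i
      ≤ ∏ _i : ι, ∑ j, hV.isHermitian.eigenvalues j :=
        Finset.prod_le_prod (fun i _ => (hV.eigenvalues_pos i).le) fun i _ =>
          Finset.single_le_sum (fun j _ => (hV.eigenvalues_pos j).le) (Finset.mem_univ i)
    _ = _ := by simp

/-- The accumulated leverage grows at most logarithmically in the energy of the regressors. -/
theorem exists_sum_leverage_le {α : ℝ} (hα : 0 < α) (x : ℕ → ι → ℝ) :
    ∃ C : ℝ, 0 ≤ C ∧ ∀ k, ∑ t ∈ Finset.range k, leverage α x t ≤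
      C * Real.log (Real.exp 1 + ∑ t ∈ Finset.range k, x t ⬝ᵥ x t) := by
  set d := Fintype.card ι
  set B := α * d + 1
  have hB : 1 ≤ B := by simp only [B]; have : 0 ≤ α * d := by positivity
                        linarith
  refine ⟨d * (Real.log B + 1) + |Real.log (infoMatrix α x 0).det|, ?_, fun k => ?_⟩
  · have := Real.log_nonneg hB; positivity
  have hs : 0 ≤ ∑ t ∈ Finset.range k, x t ⬝ᵥ x t :=
    Finset.sum_nonneg fun t _ => by simpa using dotProduct_star_self_nonneg (x t)
  set s := ∑ t ∈ Finset.range k, x t ⬝ᵥ x t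
  have he : 1 ≤ Real.exp 1 := Real.one_le_exp zero_le_one
  have hL : 1 ≤ Real.log (Real.exp 1 + s) := by
    rw [Real.le_log_iff_exp_le (by positivity)]; linarith
  have hdet : (infoMatrix α x k).det ≤ (B * (Real.exp 1 + s)) ^ d := by
    refine (det_le_trace_pow (posDef_infoMatrix hα x k)).trans ?_
    refine pow_le_pow_left₀ (posDef_infoMatrix hα x k).posSemidef.trace_nonneg ?_ _
    rw [trace_infoMatrix]
    have : 0 ≤ α * d := by positivity
    nlinarith [mul_nonneg this hs]
  have hlog : Real.log (infoMatrix α x k).det ≤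
      d * (Real.log B + Real.log (Real.exp 1 + s)) := by
    refine (Real.log_le_log (posDef_infoMatrix hα x k).det_pos hdet).trans ?_
    rw [Real.log_pow, Real.log_mul (by positivity) (by positivity)]
  have hB' := Real.log_nonneg hB
  have h1 : (d : ℝ) * Real.log B ≤ d * Real.log B * Real.log (Real.exp 1 + s) :=
    le_mul_of_one_le_right (by positivity) hL
  have h2 : |Real.log (infoMatrix α x 0).det| ≤
      |Real.log (infoMatrix α x 0).det| * Real.log (Real.exp 1 + s) :=
    le_mul_of_one_le_right (abs_nonneg _) hL
  nlinarith [sum_leverage_le_log_det hα x k, neg_abs_le (Real.log (infoMatrix α x 0).det)]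

theorem lambdaMin_mul_le {V : Matrix ι ι ℝ} (hV : V.IsHermitian) (z : ι → ℝ) :
    MPARX.lambdaMin V * (z ⬝ᵥ z) ≤ z ⬝ᵥ (V *ᵥ z) := by
  set l := MPARX.lambdaMin V
  have hH : (V - algebraMap ℝ (Matrix ι ι ℝ) l).IsHermitian := by
    refine hV.sub ?_
    simp [Matrix.IsHermitian, Matrix.algebraMap_eq_diagonal]
  have hset : {μ : ℝ | Module.End.HasEigenvalue (Matrix.toLin' V) μ} = spectrum ℝ V := by
    ext μ
    rw [Set.mem_ofPred_eq, Module.End.hasEigenvalue_iff_mem_spectrum, Matrix.spectrum_toLin']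
  have hpsd : (V - algebraMap ℝ (Matrix ι ι ℝ) l).PosSemidef := by
    rw [hH.posSemidef_iff_eigenvalues_nonneg]
    intro i
    have h1 := hH.eigenvalues_mem_spectrum_real i
    have hμ : hH.eigenvalues i + l ∈ spectrum ℝ V := by
      rw [spectrum.mem_iff] at h1 ⊢
      rwa [map_add, add_sub_assoc, ← neg_sub V, ← sub_eq_add_neg]
    have h3 : l ≤ hH.eigenvalues i + l := by
      refine csInf_le ?_ (hset ▸ hμ)
      rw [hset]
      exact (Matrix.finite_real_spectrum (A := V)).bddBelow
    simp only [Pi.zero_apply]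
    linarith
  have := hpsd.dotProduct_mulVec_nonneg z
  simp only [star_trivial, Matrix.sub_mulVec, dotProduct_sub, Algebra.algebraMap_eq_smul_one,
    Matrix.smul_mulVec, Matrix.one_mulVec, dotProduct_smul, smul_eq_mul] at this
  linarith

end LeastSquares

namespace LeastSquares

/-- Abel summation: weighting the increments of a bounded sequence by a monotone sequence. -/
theorem abs_sum_mul_le_of_bounded_partial_sums {n d : ℕ → ℝ} (hn : Monotone n) (hn0 : 0 ≤ n 0)
    {B : ℝ} (hB : ∀ k, |∑ t ∈ Finset.range k, d t| ≤ B) (k : ℕ) :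
    |∑ t ∈ Finset.range k, n (t + 1) * d t| ≤ 2 * B * n k := by
  have key : ∀ k, ∑ t ∈ Finset.range k, n (t + 1) * d t = n k * ∑ t ∈ Finset.range k, d t -
      ∑ t ∈ Finset.range k, (n (t + 1) - n t) * ∑ j ∈ Finset.range t, d j := by
    intro k
    induction k with
    | zero => simp
    | succ k ih =>
      rw [Finset.sum_range_succ, ih, Finset.sum_range_succ d, Finset.sum_range_succ (fun t => (_ * _))]
      ring
  have hB0 : 0 ≤ B := (abs_nonneg _).trans (hB 0)
  have hnk : 0 ≤ n k := hn0.trans (hn (Nat.zero_le k))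
  have h1 : |n k * ∑ t ∈ Finset.range k, d t| ≤ n k * B := by
    rw [abs_mul, abs_of_nonneg hnk]
    exact mul_le_mul_of_nonneg_left (hB k) hnk
  have h2 : |∑ t ∈ Finset.range k, (n (t + 1) - n t) * ∑ j ∈ Finset.range t, d j| ≤
      (n k - n 0) * B := by
    refine (Finset.abs_sum_le_sum_abs _ _).trans ?_
    rw [← Finset.sum_range_sub, Finset.sum_mul]
    refine Finset.sum_le_sum fun t _ => ?_
    have h := sub_nonneg.2 (hn t.le_succ)
    rw [abs_mul, abs_of_nonneg h]
    exact mul_le_mul_of_nonneg_left (hB t) h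
  rw [key]
  refine (abs_sub _ _).trans ?_
  nlinarith

theorem sub_div_rpow_le {s x y : ℝ} (hs : 1 < s) (hx : 0 < x) (hxy : x ≤ y) :
    (y - x) / y ^ s ≤ (x ^ (1 - s) - y ^ (1 - s)) / (s - 1) := by
  have hy : 0 < y := hx.trans_le hxy
  have h1 : Real.log (x / y) ≤ x / y - 1 := Real.log_le_sub_one_of_pos (by positivity)
  have h2 : 1 + (1 - s) * Real.log (x / y) ≤ (x / y) ^ (1 - s) := by
    rw [Real.rpow_def_of_pos (by positivity)]
    linarith [Real.add_one_le_exp (Real.log (x / y) * (1 - s))]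
  have h3 : 1 + (s - 1) * (1 - x / y) ≤ (x / y) ^ (1 - s) := by nlinarith
  rw [Real.div_rpow hx.le hy.le] at h3
  have hyp : 0 < y ^ (1 - s) := by positivity
  rw [le_div_iff₀ hyp] at h3
  have h4 : y ^ (1 - s) = y / y ^ s := by rw [Real.rpow_sub hy, Real.rpow_one]
  rw [le_div_iff₀ (by linarith)]
  have h5 : (y - x) / y ^ s = (1 - x / y) * y ^ (1 - s) := by rw [h4]; field_simp
  rw [h5]
  nlinarith

theorem sum_sub_div_rpow_le {A : ℕ → ℝ} (hA : Monotone A) (hA0 : A 0 = 1) {s : ℝ} (hs : 1 < s)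
    (k : ℕ) : ∑ t ∈ Finset.range k, (A (t + 1) - A t) / A (t + 1) ^ s ≤ 1 / (s - 1) := by
  have hpos : ∀ t, 0 < A t := fun t => by linarith [hA (Nat.zero_le t)]
  have h : ∑ t ∈ Finset.range k, (A (t + 1) - A t) / A (t + 1) ^ s ≤
      ∑ t ∈ Finset.range k, (A t ^ (1 - s) / (s - 1) - A (t + 1) ^ (1 - s) / (s - 1)) :=
    Finset.sum_le_sum fun t _ => by
      rw [← sub_div]; exact sub_div_rpow_le hs (hpos t) (hA t.le_succ)
  rw [Finset.sum_range_sub'] at h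
  have : 0 ≤ A k ^ (1 - s) / (s - 1) := by
    have := hpos k
    have : 0 < s - 1 := by linarith
    positivity
  rw [hA0, Real.one_rpow] at h
  linarith

/-- The slowly growing normalizer `x (1 + log x) ^ κ`. -/
noncomputable def logNormalizer (κ x : ℝ) : ℝ := x * (1 + Real.log x) ^ κ

theorem logNormalizer_pos {κ x : ℝ} (hx : 1 ≤ x) : 0 < logNormalizer κ x := by
  have := Real.log_nonneg hx
  unfold logNormalizer; positivity

theorem one_le_logNormalizer {κ x : ℝ} (hκ : 0 ≤ κ) (hx : 1 ≤ x) : 1 ≤ logNormalizer κ x := by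
  have := Real.log_nonneg hx
  exact one_le_mul_of_one_le_of_one_le hx (Real.one_le_rpow (by linarith) hκ)

theorem logNormalizer_mono {κ x y : ℝ} (hκ : 0 ≤ κ) (hx : 1 ≤ x) (hxy : x ≤ y) :
    logNormalizer κ x ≤ logNormalizer κ y := by
  have := Real.log_nonneg hx
  have := Real.log_le_log (by linarith) hxy
  have : 0 ≤ y := by linarith
  unfold logNormalizer
  gcongr

theorem sum_sub_div_logNormalizer_le {A : ℕ → ℝ} (hA : Monotone A) (hA0 : A 0 = 1) {κ : ℝ}
    (hκ : 1 < κ) (k : ℕ) :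
    ∑ t ∈ Finset.range k, (A (t + 1) - A t) / logNormalizer κ (A (t + 1)) ≤ 1 / (κ - 1) := by
  have hpos : ∀ t, 1 ≤ A t := fun t => by linarith [hA (Nat.zero_le t)]
  have hL : Monotone fun t => 1 + Real.log (A t) := fun s t hst =>
    add_le_add le_rfl (Real.log_le_log (by linarith [hpos s]) (hA hst))
  refine le_trans (Finset.sum_le_sum fun t _ => ?_)
    (sum_sub_div_rpow_le hL (by simp [hA0]) hκ k)
  have h0 := hpos t
  have h1 := hpos (t + 1)
  have h2 := Real.log_nonneg h1
  unfold logNormalizer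
  rw [← div_div]
  gcongr
  have h3 := Real.one_sub_inv_le_log_of_pos (x := A (t + 1) / A t) (by positivity)
  rw [Real.log_div (by positivity) (by positivity), inv_div] at h3
  have h4 : (A (t + 1) - A t) / A (t + 1) = 1 - A t / A (t + 1) := by field_simp
  linarith

/-- A sublinear power is absorbed by a half. -/
theorem exists_mul_rpow_le_half_add (B : ℝ) {s : ℝ} (hs0 : 0 < s) (hs : s < 1) :
    ∃ C, 0 ≤ C ∧ ∀ x : ℝ, 1 ≤ x → B * x ^ s ≤ x / 2 + C := by
  have h := (tendsto_rpow_neg_atTop (y := 1 - s) (by linarith)).const_mul B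
  rw [mul_zero] at h
  obtain ⟨X, hX⟩ := eventually_atTop.1 (h.eventually (ge_mem_nhds (show (0:ℝ) < 1 / 2 by norm_num)))
  refine ⟨|B| * (max X 1) ^ s, by positivity, fun x hx => ?_⟩
  have hx0 : 0 < x := by linarith
  rcases le_total X x with hXx | hXx
  · have h1 := hX x hXx
    have h2 : x ^ s = x ^ (-(1 - s)) * x := by
      rw [← Real.rpow_add_one hx0.ne']; ring_nf
    have h3 : 0 ≤ |B| * (max X 1) ^ s := by positivity
    rw [h2]
    nlinarith
  · have h1 : x ^ s ≤ (max X 1) ^ s :=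
      Real.rpow_le_rpow hx0.le (hXx.trans (le_max_left _ _)) hs0.le
    have h2 : B * x ^ s ≤ |B| * x ^ s := by gcongr; exact le_abs_self B
    have h3 : |B| * x ^ s ≤ |B| * (max X 1) ^ s := by gcongr
    linarith

end LeastSquares

namespace LeastSquares

/-- The pointwise inequality behind the von Bahr–Esseen bound, at the base point `1`. -/
theorem abs_one_add_rpow_le {γ : ℝ} (h1 : 1 < γ) (h2 : γ ≤ 2) (s : ℝ) :
    |1 + s| ^ γ ≤ 1 + γ * s + 6 * |s| ^ γ := by
  rcases le_total |s| 1 with hs | hs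
  · obtain ⟨hs1, hs2⟩ := abs_le.1 hs
    have h0 : 0 ≤ 1 + s := by linarith
    have hb := rpow_one_add_le_one_add_mul_self hs1 (p := γ - 1) (by linarith) (by linarith)
    have hsq : s ^ 2 ≤ |s| ^ γ := by
      rw [← sq_abs, ← Real.rpow_natCast]
      exact Real.rpow_le_rpow_of_exponent_ge_of_imp (abs_nonneg s) hs (by simpa using h2)
        (fun _ h => by norm_num at h)
    have hs0 : 0 ≤ |s| ^ γ := by positivity
    have he : |1 + s| ^ γ = (1 + s) * (1 + s) ^ (γ - 1) := by
      rw [abs_of_nonneg h0, mul_comm, ← Real.rpow_add_one' h0 (by linarith), sub_add_cancel]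
    rw [he]
    have := mul_le_mul_of_nonneg_left hb h0
    nlinarith
  · have h3 : |1 + s| ≤ 2 * |s| := (abs_add_le 1 s).trans (by rw [abs_one]; linarith)
    have h4 : |1 + s| ^ γ ≤ 4 * |s| ^ γ := by
      refine (Real.rpow_le_rpow (abs_nonneg _) h3 (by linarith)).trans ?_
      rw [Real.mul_rpow (by norm_num) (abs_nonneg s)]
      gcongr
      calc (2:ℝ) ^ γ ≤ 2 ^ (2:ℝ) := Real.rpow_le_rpow_of_exponent_le (by norm_num) h2
        _ = 4 := by norm_num
    have h5 : |s| ≤ |s| ^ γ := by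
      simpa using Real.rpow_le_rpow_of_exponent_le hs h1.le
    have h6 : -(2 * |s|) ≤ γ * s := by nlinarith [neg_abs_le s, abs_nonneg s]
    linarith

theorem abs_add_rpow_le {γ : ℝ} (h1 : 1 < γ) (h2 : γ ≤ 2) (x y : ℝ) :
    |x + y| ^ γ ≤ |x| ^ γ + γ * (SignType.sign x * |x| ^ (γ - 1) * y) + 6 * |y| ^ γ := by
  rcases eq_or_ne x 0 with rfl | hx
  · have : 0 ≤ |y| ^ γ := by positivity
    simp [Real.zero_rpow (show γ ≠ 0 by linarith)]
    linarith
  · have hx' : 0 < |x| := abs_pos.2 hx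
    have h := mul_le_mul_of_nonneg_left (abs_one_add_rpow_le h1 h2 (y / x))
      (show 0 ≤ |x| ^ γ by positivity)
    have e1 : |x| ^ γ * |1 + y / x| ^ γ = |x + y| ^ γ := by
      rw [← Real.mul_rpow (abs_nonneg _) (abs_nonneg _), ← abs_mul]
      congr 2; field_simp
    have e2 : |x| ^ γ * |y / x| ^ γ = |y| ^ γ := by
      rw [← Real.mul_rpow (abs_nonneg _) (abs_nonneg _), ← abs_mul]
      congr 2; field_simp
    have e3 : |x| ^ γ * (y / x) = SignType.sign x * |x| ^ (γ - 1) * y := by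
      rw [Real.rpow_sub_one hx'.ne']
      rcases lt_or_gt_of_ne hx with h | h
      · rw [sign_neg h, abs_of_neg h]; simp; field_simp
      · rw [sign_pos h, abs_of_pos h]; simp; field_simp
    rw [e1] at h
    linear_combination h + 6 * e2 + γ * e3

variable {Ω : Type*} {mΩ : MeasurableSpace Ω} {P : Measure Ω} [IsProbabilityMeasure P]

theorem integral_mul_eq_integral_mul_condExp {m : MeasurableSpace Ω} (hm : m ≤ mΩ) {Z ζ : Ω → ℝ}
    (hZ : StronglyMeasurable[m] Z) (hζ : Integrable ζ P)
    (hZζ : Integrable (fun ω => Z ω * ζ ω) P) :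
    ∫ ω, Z ω * ζ ω ∂P = ∫ ω, Z ω * (P[ζ|m]) ω ∂P := by
  rw [← integral_condExp hm]
  exact integral_congr_ae (condExp_mul_of_stronglyMeasurable_left hZ hZζ hζ)

theorem integrable_bdd_mul {e ζ : Ω → ℝ} (he : Measurable e) {c : ℝ}
    (he1 : ∀ ω, |e ω| ≤ c) (hζ : Integrable ζ P) :
    Integrable (fun ω => e ω * ζ ω) P :=
  hζ.bdd_mul (c := c) he.aestronglyMeasurable (Eventually.of_forall he1)

theorem integral_bdd_mul_le {m : MeasurableSpace Ω} (hm : m ≤ mΩ) {e ζ : Ω → ℝ} {c N : ℝ}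
    (he : Measurable[m] e) (he0 : ∀ ω, 0 ≤ e ω) (he1 : ∀ ω, e ω ≤ c) (hζ : Integrable ζ P)
    (hN : ∀ᵐ ω ∂P, (P[ζ|m]) ω ≤ N) :
    ∫ ω, e ω * ζ ω ∂P ≤ N * ∫ ω, e ω ∂P := by
  have hea : ∀ ω, |e ω| ≤ c := fun ω => by rw [abs_of_nonneg (he0 ω)]; exact he1 ω
  have he' := he.mono hm le_rfl
  rw [integral_mul_eq_integral_mul_condExp hm he.stronglyMeasurable hζ
    (integrable_bdd_mul he' hea hζ), ← integral_const_mul]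
  refine integral_mono_ae (integrable_bdd_mul he' hea integrable_condExp)
    (Integrable.const_mul (by simpa using integrable_bdd_mul he' hea (integrable_const (1:ℝ))) N) ?_
  filter_upwards [hN] with ω h
  rw [mul_comm N]
  exact mul_le_mul_of_nonneg_left h (he0 ω)

/-- A martingale transform with bounded coefficients is almost surely bounded if the conditional
`γ`-moments of the increments are summable, for some `1 < γ ≤ 2`. -/
theorem ae_bounded_martingale_transform {ℱ : Filtration ℕ mΩ} {e ζ : ℕ → Ω → ℝ} {γ N K : ℝ}
    (h1 : 1 < γ) (h2 : γ ≤ 2) (he : ∀ t, Measurable[ℱ t] (e t)) (he1 : ∀ t ω, |e t ω| ≤ 1)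
    (hK : ∀ k ω, ∑ t ∈ Finset.range k, |e t ω| ^ γ ≤ K) (hN : 0 ≤ N)
    (hζm : ∀ t, Measurable[ℱ (t + 1)] (ζ (t + 1))) (hζi : ∀ t, Integrable (ζ (t + 1)) P)
    (hζ0 : ∀ t, P[ζ (t + 1)|ℱ t] =ᵐ[P] 0)
    (hζγ : ∀ t, Integrable (fun ω => |ζ (t + 1) ω| ^ γ) P)
    (hζN : ∀ t, ∀ᵐ ω ∂P, (P[fun ω => |ζ (t + 1) ω| ^ γ|ℱ t]) ω ≤ N) :
    ∀ᵐ ω ∂P, ∃ B, ∀ k, |∑ t ∈ Finset.range k, e t ω * ζ (t + 1) ω| ≤ B := by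
  set M : ℕ → Ω → ℝ := fun k ω => ∑ t ∈ Finset.range k, e t ω * ζ (t + 1) ω with hM
  have he' : ∀ t, Measurable (e t) := fun t => (he t).mono (ℱ.le t) le_rfl
  have hMs : ∀ k ω, M (k + 1) ω = M k ω + e k ω * ζ (k + 1) ω := fun k ω => by
    simp [hM, Finset.sum_range_succ]
  have hMm : ∀ k, Measurable[ℱ k] (M k) := fun k =>
    Finset.measurable_fun_sum _ fun t ht => by
      have htk : t + 1 ≤ k := Finset.mem_range.1 ht
      exact ((he t).mono (ℱ.mono (by omega)) le_rfl).mul ((hζm t).mono (ℱ.mono htk) le_rfl)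
  have hinc : ∀ k, Integrable (fun ω => e k ω * ζ (k + 1) ω) P := fun k =>
    integrable_bdd_mul (he' k) (he1 k) (hζi k)
  have hMi : ∀ k, Integrable (M k) P := fun k => integrable_finsetSum _ fun t _ => hinc t
  have hmart : Martingale M ℱ P := by
    refine martingale_of_condExp_sub_eq_zero_nat (fun k => (hMm k).stronglyMeasurable) hMi ?_
    intro k
    have : M (k + 1) - M k = fun ω => e k ω * ζ (k + 1) ω := by
      ext ω; simp [hMs]
    rw [this]
    refine (condExp_mul_of_stronglyMeasurable_left (he k).stronglyMeasurable (hinc k)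
      (hζi k)).trans ?_
    filter_upwards [hζ0 k] with ω hω
    simp [hω]
  have heγ : ∀ k, Measurable[ℱ k] (fun ω => |e k ω| ^ γ) := fun k =>
    (show Measurable fun x : ℝ => |x| ^ γ by fun_prop).comp (he k)
  have heγ1 : ∀ k ω, |e k ω| ^ γ ≤ 1 := fun k ω =>
    Real.rpow_le_one (abs_nonneg _) (he1 k ω) (by linarith)
  have heγi : ∀ k, Integrable (fun ω => |e k ω| ^ γ) P := fun k => by
    simpa using integrable_bdd_mul ((heγ k).mono (ℱ.le k) le_rfl) (c := 1)
      (fun ω => by rw [abs_of_nonneg (by positivity)]; exact heγ1 k ω) (integrable_const (1:ℝ))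
  have hmom : ∀ k, Integrable (fun ω => |M k ω| ^ γ) P ∧
      ∫ ω, |M k ω| ^ γ ∂P ≤ 6 * (N * ∑ t ∈ Finset.range k, ∫ ω, |e t ω| ^ γ ∂P) := by
    intro k
    induction k with
    | zero => simp [hM, Real.zero_rpow (show γ ≠ 0 by linarith)]
    | succ k ih =>
      obtain ⟨ihi, ihb⟩ := ih
      set J : Ω → ℝ := fun ω => SignType.sign (M k ω) * |M k ω| ^ (γ - 1) * e k ω
      have hsign : Measurable (fun x : ℝ => ((SignType.sign x : SignType) : ℝ)) := by
        have : (fun x : ℝ => ((SignType.sign x : SignType) : ℝ)) =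
            fun x => if 0 < x then 1 else if x < 0 then -1 else 0 := by
          ext x
          rcases lt_trichotomy x 0 with h | h | h
          · simp [h, h.not_gt]
          · simp [h]
          · simp [h]
        rw [this]
        exact Measurable.ite measurableSet_Ioi measurable_const
          (Measurable.ite measurableSet_Iio measurable_const measurable_const)
      have hJm : Measurable[ℱ k] J :=
        ((hsign.comp (hMm k)).mul
          ((show Measurable fun x : ℝ => |x| ^ (γ - 1) by fun_prop).comp (hMm k))).mul (he k)
      have hJb : ∀ ω, |J ω| ≤ |M k ω| ^ (γ - 1) := fun ω => by
        simp only [J, abs_mul]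
        have a1 : |((SignType.sign (M k ω) : SignType) : ℝ)| ≤ 1 := by
          rcases lt_trichotomy (M k ω) 0 with h | h | h <;> simp [h]
        have a2 : 0 ≤ |M k ω| ^ (γ - 1) := by positivity
        rw [abs_of_nonneg a2]
        calc _ ≤ 1 * |M k ω| ^ (γ - 1) * 1 := by
              gcongr; exact he1 k ω
          _ = _ := by ring
      have hJζ : Integrable (fun ω => J ω * ζ (k + 1) ω) P := by
        refine (ihi.add (hζγ k)).mono'
          ((hJm.mono (ℱ.le k) le_rfl).mul ((hζm k).mono (ℱ.le _) le_rfl)).aestronglyMeasurable ?_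
        refine Eventually.of_forall fun ω => ?_
        rw [Real.norm_eq_abs, abs_mul]
        refine (mul_le_mul_of_nonneg_right (hJb ω) (abs_nonneg _)).trans ?_
        simp only [Pi.add_apply]
        have split : ∀ x : ℝ, 0 ≤ x → x ^ (γ - 1) * x = x ^ γ := fun x hx => by
          rw [← Real.rpow_add_one' hx (by linarith), sub_add_cancel]
        rcases le_total |M k ω| |ζ (k + 1) ω| with h | h
        · have : |M k ω| ^ (γ - 1) * |ζ (k + 1) ω| ≤ |ζ (k + 1) ω| ^ γ := by
            rw [← split _ (abs_nonneg (ζ (k + 1) ω))]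
            gcongr
          have : 0 ≤ |M k ω| ^ γ := by positivity
          linarith
        · have : |M k ω| ^ (γ - 1) * |ζ (k + 1) ω| ≤ |M k ω| ^ γ := by
            rw [← split _ (abs_nonneg (M k ω))]
            gcongr
          have : 0 ≤ |ζ (k + 1) ω| ^ γ := by positivity
          linarith
      have hcross : ∫ ω, J ω * ζ (k + 1) ω ∂P = 0 := by
        rw [integral_mul_eq_integral_mul_condExp (ℱ.le k) hJm.stronglyMeasurable (hζi k) hJζ]
        refine integral_eq_zero_of_ae ?_
        filter_upwards [hζ0 k] with ω hω
        simp [hω]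
      have heζi : Integrable (fun ω => |e k ω| ^ γ * |ζ (k + 1) ω| ^ γ) P :=
        integrable_bdd_mul ((heγ k).mono (ℱ.le k) le_rfl) (c := 1)
          (fun ω => by rw [abs_of_nonneg (by positivity)]; exact heγ1 k ω) (hζγ k)
      have hle : ∀ ω, |M (k + 1) ω| ^ γ ≤ |M k ω| ^ γ + γ * (J ω * ζ (k + 1) ω) +
          6 * (|e k ω| ^ γ * |ζ (k + 1) ω| ^ γ) := fun ω => by
        have := abs_add_rpow_le h1 h2 (M k ω) (e k ω * ζ (k + 1) ω)
        rw [← hMs, abs_mul, Real.mul_rpow (abs_nonneg _) (abs_nonneg _)] at this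
        simp only [J]
        linarith
      have hint := (ihi.add (hJζ.const_mul γ)).add (heζi.const_mul 6)
      have hMi' : Integrable (fun ω => |M (k + 1) ω| ^ γ) P := by
        refine hint.mono' ((((hMm (k + 1)).mono (ℱ.le _) le_rfl).abs.pow_const γ)
          |>.aestronglyMeasurable) (Eventually.of_forall fun ω => ?_)
        rw [Real.norm_eq_abs, abs_of_nonneg (by positivity)]
        exact hle ω
      refine ⟨hMi', (integral_mono hMi' hint hle).trans ?_⟩
      rw [integral_add' (ihi.add (hJζ.const_mul γ)) (heζi.const_mul 6), integral_add' ihi (hJζ.const_mul γ), integral_const_mul, integral_const_mul, hcross,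
        Finset.sum_range_succ]
      have := integral_bdd_mul_le (ℱ.le k) (heγ k) (fun ω => by positivity) (heγ1 k) (hζγ k)
        (hζN k)
      linarith
  have hbound : ∀ k, ∫ ω, |M k ω| ^ γ ∂P ≤ 6 * (N * K) := fun k => by
    refine (hmom k).2.trans ?_
    rw [← integral_finsetSum _ fun t _ => heγi t]
    gcongr
    calc _ ≤ ∫ _, K ∂P := integral_mono (integrable_finsetSum _ fun t _ => heγi t)
          (integrable_const K) (hK k)
      _ = K := by simp
  have hL1 : ∀ k, eLpNorm (M k) 1 P ≤ (Real.toNNReal (1 + 6 * (N * K)) : ℝ≥0∞) := fun k => by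
    rw [eLpNorm_one_eq_lintegral_enorm, ← ofReal_integral_norm_eq_lintegral_enorm (hMi k)]
    refine ENNReal.ofReal_le_ofReal ?_
    calc ∫ ω, ‖M k ω‖ ∂P ≤ ∫ ω, (1 + |M k ω| ^ γ) ∂P := by
          refine integral_mono (hMi k).norm ((integrable_const 1).add (hmom k).1) fun ω => ?_
          simp only [Real.norm_eq_abs]
          rcases le_total |M k ω| 1 with h | h
          · have : 0 ≤ |M k ω| ^ γ := by positivity
            linarith
          · have := Real.rpow_le_rpow_of_exponent_le h h1.le
            rw [Real.rpow_one] at this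
            linarith
      _ = 1 + ∫ ω, |M k ω| ^ γ ∂P := by
          rw [integral_add (integrable_const 1) (hmom k).1]; simp
      _ ≤ _ := by linarith [hbound k]
  filter_upwards [hmart.submartingale.exists_ae_tendsto_of_bdd hL1] with ω ⟨c, hc⟩
  obtain ⟨B, hB⟩ := hc.abs.bddAbove_range
  exact ⟨B, fun k => hB ⟨k, rfl⟩⟩

/-- A series of nonnegative terms with bounded conditional means and summable coefficients is
almost surely bounded. -/
theorem ae_bounded_sum_of_nonneg {ℱ : Filtration ℕ mΩ} {e ζ : ℕ → Ω → ℝ} {N K : ℝ}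
    (he : ∀ t, Measurable[ℱ t] (e t)) (he0 : ∀ t ω, 0 ≤ e t ω) (he1 : ∀ t ω, e t ω ≤ 1)
    (hK : ∀ k ω, ∑ t ∈ Finset.range k, e t ω ≤ K) (hN : 0 ≤ N)
    (hζi : ∀ t, Integrable (ζ (t + 1)) P) (hζ0 : ∀ t ω, 0 ≤ ζ (t + 1) ω)
    (hζN : ∀ t, ∀ᵐ ω ∂P, (P[ζ (t + 1)|ℱ t]) ω ≤ N) :
    ∀ᵐ ω ∂P, ∃ B, ∀ k, ∑ t ∈ Finset.range k, e t ω * ζ (t + 1) ω ≤ B := by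
  have he' : ∀ t, Measurable (e t) := fun t => (he t).mono (ℱ.le t) le_rfl
  have hea : ∀ t ω, |e t ω| ≤ 1 := fun t ω => by rw [abs_of_nonneg (he0 t ω)]; exact he1 t ω
  have hinc : ∀ k, Integrable (fun ω => e k ω * ζ (k + 1) ω) P := fun k =>
    integrable_bdd_mul (he' k) (hea k) (hζi k)
  have hei : ∀ k, Integrable (e k) P := fun k => by
    simpa using integrable_bdd_mul (he' k) (hea k) (integrable_const (1:ℝ))
  have hpart : ∀ k, ∑ t ∈ Finset.range k, ∫ ω, e t ω * ζ (t + 1) ω ∂P ≤ N * K := fun k => by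
    calc _ ≤ ∑ t ∈ Finset.range k, N * ∫ ω, e t ω ∂P := Finset.sum_le_sum fun t _ =>
          integral_bdd_mul_le (ℱ.le t) (he t) (he0 t) (he1 t) (hζi t) (hζN t)
      _ = N * ∫ ω, ∑ t ∈ Finset.range k, e t ω ∂P := by
          rw [integral_finsetSum _ fun t _ => hei t, Finset.mul_sum]
      _ ≤ N * K := by
          gcongr
          calc _ ≤ ∫ _, K ∂P := integral_mono (integrable_finsetSum _ fun t _ => hei t)
                (integrable_const K) (hK k)
            _ = K := by simp
  have hfin : ∫⁻ ω, ∑' t, ENNReal.ofReal (e t ω * ζ (t + 1) ω) ∂P ≠ ∞ := by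
    rw [lintegral_tsum fun t => (hinc t).aemeasurable.ennreal_ofReal]
    refine ne_top_of_le_ne_top (ENNReal.ofReal_ne_top (r := N * K))
      (ENNReal.tsum_le_of_sum_range_le fun k => ?_)
    refine le_trans (le_of_eq ?_) (ENNReal.ofReal_le_ofReal (hpart k))
    rw [ENNReal.ofReal_sum_of_nonneg fun t _ => integral_nonneg fun ω =>
      mul_nonneg (he0 t ω) (hζ0 t ω)]
    refine Finset.sum_congr rfl fun t _ => ?_
    rw [ofReal_integral_eq_lintegral_ofReal (hinc t)
      (Eventually.of_forall fun ω => mul_nonneg (he0 t ω) (hζ0 t ω))]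
  have hmeas : AEMeasurable (fun ω => ∑' t, ENNReal.ofReal (e t ω * ζ (t + 1) ω)) P :=
    AEMeasurable.tsum fun t => (hinc t).aemeasurable.ennreal_ofReal
  filter_upwards [ae_lt_top' hmeas hfin] with ω hω
  refine ⟨(∑' t, ENNReal.ofReal (e t ω * ζ (t + 1) ω)).toReal, fun k => ?_⟩
  rw [← ENNReal.ofReal_le_iff_le_toReal hω.ne, ENNReal.ofReal_sum_of_nonneg fun t _ =>
    mul_nonneg (he0 t ω) (hζ0 t ω)]
  exact ENNReal.sum_le_tsum _

end LeastSquares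

namespace LeastSquares

section Measurability

variable {Ω ι : Type*} [Fintype ι] [DecidableEq ι] {m : MeasurableSpace Ω}

theorem measurable_det {A : Ω → Matrix ι ι ℝ} (hA : ∀ i j, Measurable fun ω => A ω i j) :
    Measurable fun ω => (A ω).det := by
  simp only [Matrix.det_apply]
  exact Finset.measurable_fun_sum _ fun σ _ =>
    (Finset.measurable_fun_prod _ fun i _ => hA _ _).const_smul _

theorem measurable_inv_apply {A : Ω → Matrix ι ι ℝ} (hA : ∀ i j, Measurable fun ω => A ω i j)
    (i j : ι) : Measurable fun ω => (A ω)⁻¹ i j := by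
  simp only [Matrix.inv_def, Matrix.smul_apply, Ring.inverse_eq_inv', Matrix.adjugate_apply,
    smul_eq_mul]
  refine (measurable_det hA).inv.mul (measurable_det fun k l => ?_)
  by_cases hk : k = j
  · subst hk; simp
  · simpa [Matrix.updateRow_ne hk] using hA k l

theorem measurable_quadratic {A : Ω → Matrix ι ι ℝ} (hA : ∀ i j, Measurable fun ω => A ω i j)
    {y z : Ω → ι → ℝ} (hy : Measurable y) (hz : Measurable z) :
    Measurable fun ω => y ω ⬝ᵥ (A ω *ᵥ z ω) := by
  simp only [dotProduct, Matrix.mulVec]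
  exact Finset.measurable_fun_sum _ fun i _ => (measurable_pi_iff.1 hy i).mul
    (Finset.measurable_fun_sum _ fun j _ => (hA i j).mul (measurable_pi_iff.1 hz j))

theorem measurable_infoMatrix_apply (α : ℝ) {x : ℕ → Ω → ι → ℝ} {k : ℕ}
    (hx : ∀ t < k, Measurable (x t)) (i j : ι) :
    Measurable fun ω => infoMatrix α (fun t => x t ω) k i j := by
  simp only [infoMatrix, Matrix.add_apply, Matrix.sum_apply, Matrix.vecMulVec_apply]
  exact measurable_const.add (Finset.measurable_fun_sum _ fun t ht =>
    (measurable_pi_iff.1 (hx t (Finset.mem_range.1 ht)) i).mul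
      (measurable_pi_iff.1 (hx t (Finset.mem_range.1 ht)) j))

theorem measurable_score {x : ℕ → Ω → ι → ℝ} {v : ℕ → Ω → ℝ} {k : ℕ}
    (hx : ∀ t < k, Measurable (x t)) (hv : ∀ t < k, Measurable (v (t + 1))) :
    Measurable fun ω => score (fun t => x t ω) (fun t => v t ω) k :=
  Finset.measurable_fun_sum _ fun t ht =>
    (hv t (Finset.mem_range.1 ht)).smul (hx t (Finset.mem_range.1 ht))

theorem measurable_leverage (α : ℝ) {x : ℕ → Ω → ι → ℝ} {k : ℕ}
    (hx : ∀ t ≤ k, Measurable (x t)) :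
    Measurable fun ω => leverage α (fun t => x t ω) k := by
  have h := measurable_quadratic (measurable_inv_apply
    (measurable_infoMatrix_apply α fun t ht => hx t (le_of_lt ht))) (hx k le_rfl) (hx k le_rfl)
  exact h.div (measurable_const.add h)

theorem measurable_crossGain (α : ℝ) {x : ℕ → Ω → ι → ℝ} {v : ℕ → Ω → ℝ} {k : ℕ}
    (hx : ∀ t ≤ k, Measurable (x t)) (hv : ∀ t < k, Measurable (v (t + 1))) :
    Measurable fun ω => crossGain α (fun t => x t ω) (fun t => v t ω) k := by
  have hA := measurable_inv_apply (measurable_infoMatrix_apply α fun t ht => hx t (le_of_lt ht))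
  exact (measurable_quadratic hA (hx k le_rfl)
    (measurable_score (fun t ht => hx t (le_of_lt ht)) hv)).div
    (measurable_const.add (measurable_quadratic hA (hx k le_rfl) (hx k le_rfl)))

end Measurability

variable {Ω : Type*} {mΩ : MeasurableSpace Ω}

/-- Martingale differences whose conditional `β`-moments are bounded by `N`. -/
structure BoundedMartingaleNoise (P : Measure Ω) (ℱ : Filtration ℕ mΩ) (w : ℕ → Ω → ℝ)
    (β N : ℝ) : Prop where
  measurable (t : ℕ) : Measurable[ℱ (t + 1)] (w (t + 1))
  integrable (t : ℕ) : Integrable (w (t + 1)) P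
  condExp_eq_zero (t : ℕ) : P[w (t + 1)|ℱ t] =ᵐ[P] 0
  integrable_rpow (t : ℕ) : Integrable (fun ω => |w (t + 1) ω| ^ β) P
  condExp_rpow_le (t : ℕ) : ∀ᵐ ω ∂P, (P[fun ω => |w (t + 1) ω| ^ β|ℱ t]) ω ≤ N

variable {P : Measure Ω} [IsProbabilityMeasure P] {ℱ : Filtration ℕ mΩ} {w : ℕ → Ω → ℝ} {β N : ℝ}

namespace BoundedMartingaleNoise

theorem lower_moment (hw : BoundedMartingaleNoise P ℱ w β N) {s : ℝ} (hs0 : 0 ≤ s) (hs : s ≤ β)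
    (t : ℕ) : Integrable (fun ω => |w (t + 1) ω| ^ s) P ∧
      ∀ᵐ ω ∂P, (P[fun ω => |w (t + 1) ω| ^ s|ℱ t]) ω ≤ 1 + N := by
  have hle : ∀ ω, |w (t + 1) ω| ^ s ≤ 1 + |w (t + 1) ω| ^ β := fun ω => by
    have h0 : 0 ≤ |w (t + 1) ω| ^ β := by positivity
    rcases le_total |w (t + 1) ω| 1 with h | h
    · linarith [Real.rpow_le_one (abs_nonneg _) h hs0]
    · linarith [Real.rpow_le_rpow_of_exponent_le h hs]
  have hm : Measurable (w (t + 1)) := (hw.measurable t).mono (ℱ.le _) le_rfl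
  have hint : Integrable (fun ω => 1 + |w (t + 1) ω| ^ β) P :=
    (integrable_const 1).add (hw.integrable_rpow t)
  have hi : Integrable (fun ω => |w (t + 1) ω| ^ s) P :=
    hint.mono' (hm.abs.pow_const s).aestronglyMeasurable (Eventually.of_forall fun ω => by
      rw [Real.norm_eq_abs, abs_of_nonneg (by positivity)]; exact hle ω)
  refine ⟨hi, ?_⟩
  filter_upwards [condExp_mono (m := ℱ t) hi hint (Eventually.of_forall hle),
    condExp_add (integrable_const (1 : ℝ)) (hw.integrable_rpow t) (ℱ t),
    hw.condExp_rpow_le t] with ω h1 h2 h3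
  refine h1.trans ?_
  have h4 : (P[fun ω => 1 + |w (t + 1) ω| ^ β|ℱ t]) ω =
      (P[fun _ => (1 : ℝ)|ℱ t]) ω + (P[fun ω => |w (t + 1) ω| ^ β|ℱ t]) ω := h2
  rw [h4, condExp_const (ℱ.le t)]
  linarith

theorem nonneg (hw : BoundedMartingaleNoise P ℱ w β N) : 0 ≤ N := by
  have h0 : 0 ≤ᵐ[P] P[fun ω => |w (0 + 1) ω| ^ β|ℱ 0] :=
    condExp_nonneg (Eventually.of_forall fun ω => by simp only [Pi.zero_apply]; positivity)
  obtain ⟨ω, h1, h2⟩ := (h0.and (hw.condExp_rpow_le 0)).exists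
  exact h1.trans h2

variable {ι : Type*} [Fintype ι] [DecidableEq ι] {α : ℝ} {x : ℕ → Ω → ι → ℝ}

theorem ae_cross_terms_bounded (hw : BoundedMartingaleNoise P ℱ w β N) (hβ : 2 ≤ β)
    (hx : ∀ t, Measurable[ℱ t] (x t)) :
    ∀ᵐ ω ∂P, ∃ C, ∀ k,
      2 * ∑ t ∈ Finset.range k, crossGain α (fun t => x t ω) (fun t => w t ω) t * w (t + 1) ω
        - ∑ t ∈ Finset.range k, crossGain α (fun t => x t ω) (fun t => w t ω) t ^ 2 ≤ C := by
  set g : ℕ → Ω → ℝ := fun t ω => crossGain α (fun t => x t ω) (fun t => w t ω) t with hg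
  set G : ℕ → Ω → ℝ := fun k ω => 1 + ∑ t ∈ Finset.range k, g t ω ^ 2 with hG
  have hGs : ∀ k ω, G (k + 1) ω = G k ω + g k ω ^ 2 := fun k ω => by
    simp [hG, Finset.sum_range_succ, add_assoc]
  have hG0 : ∀ ω, G 0 ω = 1 := fun ω => by simp [hG]
  have hGmono : ∀ ω, Monotone fun k => G k ω := fun ω => monotone_nat_of_le_succ fun k => by
    rw [hGs]; linarith [sq_nonneg (g k ω)]
  have hG1 : ∀ k ω, 1 ≤ G k ω := fun k ω => by
    have := hGmono ω (Nat.zero_le k)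
    simp only [hG0] at this; exact this
  have hgm : ∀ t, Measurable[ℱ t] (g t) := fun t =>
    measurable_crossGain α (fun s hs => (hx s).mono (ℱ.mono hs) le_rfl)
      (fun s hs => (hw.measurable s).mono (ℱ.mono hs) le_rfl)
  have hGm : ∀ t, Measurable[ℱ t] (G (t + 1)) := fun t =>
    measurable_const.add (Finset.measurable_fun_sum _ fun s hs =>
      ((measurable_id.pow_const 2).comp
        ((hgm s).mono (ℱ.mono (Nat.lt_succ_iff.1 (Finset.mem_range.1 hs))) le_rfl)))
  have hGp : ∀ t, Measurable[ℱ t] (fun ω => G (t + 1) ω ^ (3 / 4 : ℝ)) := fun t =>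
    (show Measurable fun y : ℝ => y ^ (3 / 4 : ℝ) by fun_prop).comp (hGm t)
  have hsq : ∀ t ω, |g t ω / G (t + 1) ω ^ (3 / 4 : ℝ)| ^ (2 : ℝ) =
      (G (t + 1) ω - G t ω) / G (t + 1) ω ^ (3 / 2 : ℝ) := fun t ω => by
    have := hG1 (t + 1) ω
    have e : (G (t + 1) ω ^ (3 / 4 : ℝ)) ^ 2 = G (t + 1) ω ^ (3 / 2 : ℝ) := by
      rw [← Real.rpow_natCast, ← Real.rpow_mul (by linarith)]
      norm_num
    rw [Real.rpow_two, sq_abs, div_pow, e, hGs, add_sub_cancel_left]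
  have h := ae_bounded_martingale_transform (P := P) (ℱ := ℱ)
    (e := fun t ω => g t ω / G (t + 1) ω ^ (3 / 4 : ℝ)) (ζ := w)
    (γ := 2) (N := 1 + N) (K := 1 / (3 / 2 - 1)) (by norm_num) le_rfl
    (fun t => (hgm t).div (hGp t))
    (fun t ω => ?_) (fun k ω => ?_) (by linarith [hw.nonneg]) hw.measurable hw.integrable
    hw.condExp_eq_zero (fun t => (hw.lower_moment (by norm_num) hβ t).1)
    (fun t => (hw.lower_moment (by norm_num) hβ t).2)
  · filter_upwards [h] with ω ⟨B, hB⟩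
    obtain ⟨C, hC0, hC⟩ := exists_mul_rpow_le_half_add (4 * B) (s := 3 / 4) (by norm_num)
      (by norm_num)
    refine ⟨1 + C, fun k => ?_⟩
    have h1 := abs_sum_mul_le_of_bounded_partial_sums (n := fun k => G k ω ^ (3 / 4 : ℝ))
      (fun i j hij => Real.rpow_le_rpow (by linarith [hG1 i ω]) (hGmono ω hij) (by norm_num))
      (by simp [hG0]) hB k
    have h2 : ∑ t ∈ Finset.range k, G (t + 1) ω ^ (3 / 4 : ℝ) *
        (g t ω / G (t + 1) ω ^ (3 / 4 : ℝ) * w (t + 1) ω) =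
        ∑ t ∈ Finset.range k, g t ω * w (t + 1) ω := Finset.sum_congr rfl fun t _ => by
      have : 0 < G (t + 1) ω ^ (3 / 4 : ℝ) := Real.rpow_pos_of_pos (by linarith [hG1 (t + 1) ω]) _
      field_simp
    simp only [h2] at h1
    have h3 := hC (G k ω) (hG1 k ω)
    have h4 : G k ω = 1 + ∑ t ∈ Finset.range k, g t ω ^ 2 := rfl
    have h5 : 0 ≤ ∑ t ∈ Finset.range k, g t ω ^ 2 := Finset.sum_nonneg fun t _ => sq_nonneg _
    linarith [le_abs_self (∑ t ∈ Finset.range k, g t ω * w (t + 1) ω)]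
  · rw [← abs_of_nonneg (show 0 ≤ |_| from abs_nonneg _), ← sq_le_one_iff_abs_le_one,
      ← Real.rpow_two, hsq]
    have h1 := hG1 (t + 1) ω
    have h0 := hG1 t ω
    rw [div_le_one (by positivity)]
    calc G (t + 1) ω - G t ω ≤ G (t + 1) ω ^ (1 : ℝ) := by rw [Real.rpow_one]; linarith
      _ ≤ _ := Real.rpow_le_rpow_of_exponent_le h1 (by norm_num)
  · simp only [hsq]
    exact sum_sub_div_rpow_le (hGmono ω) (hG0 ω) (by norm_num) k

/-- One plus the accumulated leverage. -/
noncomputable def _root_.LeastSquares.leverageSum (α : ℝ) (x : ℕ → ι → ℝ) (k : ℕ) : ℝ :=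
  1 + ∑ t ∈ Finset.range k, leverage α x t

theorem _root_.LeastSquares.leverageSum_sub (α : ℝ) (x : ℕ → ι → ℝ) (k : ℕ) :
    leverageSum α x (k + 1) - leverageSum α x k = leverage α x k := by
  simp [leverageSum, Finset.sum_range_succ]

theorem _root_.LeastSquares.leverageSum_zero (α : ℝ) (x : ℕ → ι → ℝ) :
    leverageSum α x 0 = 1 := by
  simp [leverageSum]

theorem _root_.LeastSquares.leverageSum_mono (hα : 0 < α) (x : ℕ → ι → ℝ) :
    Monotone (leverageSum α x) := monotone_nat_of_le_succ fun k => by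
  linarith [leverageSum_sub α x k, leverage_nonneg hα x k]

theorem _root_.LeastSquares.one_le_leverageSum (hα : 0 < α) (x : ℕ → ι → ℝ) (k : ℕ) :
    1 ≤ leverageSum α x k :=
  (leverageSum_zero α x).ge.trans (leverageSum_mono hα x (Nat.zero_le k))

theorem _root_.LeastSquares.measurable_leverageSum (hx : ∀ t, Measurable[ℱ t] (x t)) (t : ℕ) :
    Measurable[ℱ t] (fun ω => leverageSum α (fun t => x t ω) (t + 1)) :=
  measurable_const.add (Finset.measurable_fun_sum _ fun _ hs =>
    measurable_leverage α fun r hr => (hx r).mono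
      (ℱ.mono (hr.trans (Nat.lt_succ_iff.1 (Finset.mem_range.1 hs)))) le_rfl)

theorem ae_sum_leverage_mul_sq_le (hw : BoundedMartingaleNoise P ℱ w β N) (hβ : 2 < β)
    (hα : 0 < α) (hx : ∀ t, Measurable[ℱ t] (x t)) :
    ∀ᵐ ω ∂P, ∃ C, 0 ≤ C ∧ ∀ k,
      ∑ t ∈ Finset.range k, leverage α (fun t => x t ω) t * w (t + 1) ω ^ 2 ≤
        C * leverageSum α (fun t => x t ω) k := by
  set γ := min (β / 2) 2
  have hγ1 : 1 < γ := lt_min (by linarith) (by norm_num)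
  have hγ2 : γ ≤ 2 := min_le_right _ _
  have hγβ : 2 * γ ≤ β := by have := min_le_left (β / 2) 2; simp only [γ]; linarith
  set σ : ℕ → Ω → ℝ := fun t => P[fun ω => |w (t + 1) ω| ^ (2 : ℝ)|ℱ t] with hσ
  set ζ : ℕ → Ω → ℝ := fun n ω => |w n ω| ^ (2 : ℝ) - σ (n - 1) ω with hζ
  set H : ℕ → Ω → ℝ := fun k ω => leverageSum α (fun t => x t ω) k with hH
  set h : ℕ → Ω → ℝ := fun k ω => leverage α (fun t => x t ω) k with hh
  have h2 := fun t => hw.lower_moment (s := 2) (by norm_num) hβ.le t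
  have h2γ := fun t => hw.lower_moment (s := 2 * γ) (by linarith) hγβ t
  have hwm : ∀ t, Measurable (w (t + 1)) := fun t => (hw.measurable t).mono (ℱ.le _) le_rfl
  have hN := hw.nonneg
  have hσ0 : ∀ t, 0 ≤ᵐ[P] σ t := fun t =>
    condExp_nonneg (Eventually.of_forall fun ω => by simp only [Pi.zero_apply]; positivity)
  have hσm : ∀ t, Measurable[ℱ t] (σ t) := fun t => stronglyMeasurable_condExp.measurable
  have hζm : ∀ t, Measurable[ℱ (t + 1)] (ζ (t + 1)) := fun t =>
    ((show Measurable fun y : ℝ => |y| ^ (2 : ℝ) by fun_prop).comp (hw.measurable t)).sub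
      ((hσm t).mono (ℱ.mono t.le_succ) le_rfl)
  have hζi : ∀ t, Integrable (ζ (t + 1)) P := fun t => (h2 t).1.sub integrable_condExp
  have hζ0 : ∀ t, P[ζ (t + 1)|ℱ t] =ᵐ[P] 0 := fun t => by
    have e : ζ (t + 1) = (fun ω => |w (t + 1) ω| ^ (2 : ℝ)) - σ t := rfl
    rw [e]
    filter_upwards [condExp_sub (h2 t).1 (integrable_condExp (m := ℱ t)
      (f := fun ω => |w (t + 1) ω| ^ (2 : ℝ))) (ℱ t)] with ω h1
    rw [h1, condExp_of_stronglyMeasurable (ℱ.le t) stronglyMeasurable_condExp integrable_condExp]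
    simp
  have hζle : ∀ t, ∀ᵐ ω ∂P, |ζ (t + 1) ω| ^ γ ≤
      |w (t + 1) ω| ^ (2 * γ) + (1 + N) ^ γ := fun t => by
    filter_upwards [hσ0 t, (h2 t).2] with ω h3 h4
    have h3' : 0 ≤ σ t ω := h3
    have h5 : (|w (t + 1) ω| ^ (2 : ℝ)) ^ γ = |w (t + 1) ω| ^ (2 * γ) := by
      rw [Real.rpow_mul (abs_nonneg _)]
    have h6 : 0 ≤ |w (t + 1) ω| ^ (2 : ℝ) := by positivity
    have h7 : |ζ (t + 1) ω| ≤ max (|w (t + 1) ω| ^ (2 : ℝ)) (1 + N) := by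
      have e : ζ (t + 1) ω = |w (t + 1) ω| ^ (2 : ℝ) - σ t ω := rfl
      have h4' : σ t ω ≤ 1 + N := h4
      rw [e, abs_le]
      constructor
      · linarith [le_max_right (|w (t + 1) ω| ^ (2 : ℝ)) (1 + N)]
      · linarith [le_max_left (|w (t + 1) ω| ^ (2 : ℝ)) (1 + N)]
    refine (Real.rpow_le_rpow (abs_nonneg _) h7 (by linarith)).trans ?_
    have h8 : 0 ≤ (1 + N) ^ γ := by positivity
    have h9 : 0 ≤ |w (t + 1) ω| ^ (2 * γ) := by positivity
    rcases max_choice (|w (t + 1) ω| ^ (2 : ℝ)) (1 + N) with h | h <;> rw [h]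
    · rw [h5]; linarith
    · linarith
  have hdom : ∀ t, Integrable (fun ω => |w (t + 1) ω| ^ (2 * γ) + (1 + N) ^ γ) P := fun t =>
    (h2γ t).1.add (integrable_const _)
  have hζγ : ∀ t, Integrable (fun ω => |ζ (t + 1) ω| ^ γ) P := fun t =>
    (hdom t).mono' (((hζm t).mono (ℱ.le _) le_rfl).abs.pow_const γ).aestronglyMeasurable (by
      filter_upwards [hζle t] with ω h1
      rwa [Real.norm_eq_abs, abs_of_nonneg (by positivity)])
  have hζN : ∀ t, ∀ᵐ ω ∂P, (P[fun ω => |ζ (t + 1) ω| ^ γ|ℱ t]) ω ≤ 1 + N + (1 + N) ^ γ := by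
    intro t
    filter_upwards [condExp_mono (m := ℱ t) (hζγ t) (hdom t) (hζle t),
      condExp_add (h2γ t).1 (integrable_const ((1 + N) ^ γ)) (ℱ t), (h2γ t).2] with ω h3 h4 h5
    have h6 : (P[fun ω => |w (t + 1) ω| ^ (2 * γ) + (1 + N) ^ γ|ℱ t]) ω =
      (P[fun ω => |w (t + 1) ω| ^ (2 * γ)|ℱ t]) ω + (P[fun _ => (1 + N) ^ γ|ℱ t]) ω := h4
    rw [h6, condExp_const (ℱ.le t)] at h3
    linarith
  have hHs : ∀ t ω, H (t + 1) ω - H t ω = h t ω := fun t ω => leverageSum_sub α _ t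
  have hH1 : ∀ t ω, 1 ≤ H t ω := fun t ω => one_le_leverageSum hα _ t
  have hh0 : ∀ t ω, 0 ≤ h t ω := fun t ω => leverage_nonneg hα _ t
  have hh1 : ∀ t ω, h t ω ≤ 1 := fun t ω => leverage_le_one hα _ t
  have hhm : ∀ t, Measurable[ℱ t] (h t) := fun t =>
    measurable_leverage α fun r hr => (hx r).mono (ℱ.mono hr) le_rfl
  have habs : ∀ t ω, |h t ω / H (t + 1) ω| = h t ω / H (t + 1) ω := fun t ω =>
    abs_of_nonneg (div_nonneg (hh0 t ω) (by linarith [hH1 (t + 1) ω]))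
  have key := ae_bounded_martingale_transform (P := P) (ℱ := ℱ)
    (e := fun t ω => h t ω / H (t + 1) ω) (ζ := ζ)
    (γ := γ) (N := 1 + N + (1 + N) ^ γ) (K := 1 / (γ - 1)) hγ1 hγ2
    (fun t => (hhm t).div (measurable_leverageSum hx t))
    (fun t ω => ?_) (fun k ω => ?_) (by positivity) hζm hζi hζ0 hζγ hζN
  · filter_upwards [key, ae_all_iff.2 fun t => (h2 t).2] with ω ⟨B, hB⟩ hω
    have hB0 : 0 ≤ B := (abs_nonneg _).trans (hB 0)
    refine ⟨2 * B + (1 + N), by positivity, fun k => ?_⟩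
    have h1 := abs_sum_mul_le_of_bounded_partial_sums (n := fun k => H k ω)
      (leverageSum_mono hα _) (by linarith [hH1 0 ω]) hB k
    have e1 : ∑ t ∈ Finset.range k, H (t + 1) ω * (h t ω / H (t + 1) ω * ζ (t + 1) ω) =
        ∑ t ∈ Finset.range k, h t ω * ζ (t + 1) ω := Finset.sum_congr rfl fun t _ => by
      have := hH1 (t + 1) ω
      field_simp
    simp only [e1] at h1
    have e2 : ∑ t ∈ Finset.range k, h t ω * w (t + 1) ω ^ 2 =
        ∑ t ∈ Finset.range k, h t ω * ζ (t + 1) ω + ∑ t ∈ Finset.range k, h t ω * σ t ω := by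
      rw [← Finset.sum_add_distrib]
      refine Finset.sum_congr rfl fun t _ => ?_
      have e : ζ (t + 1) ω = |w (t + 1) ω| ^ (2 : ℝ) - σ t ω := rfl
      rw [e, Real.rpow_two, sq_abs]; ring
    have e3 : ∑ t ∈ Finset.range k, h t ω * σ t ω ≤ (1 + N) * ∑ t ∈ Finset.range k, h t ω := by
      rw [Finset.mul_sum]
      refine Finset.sum_le_sum fun t _ => ?_
      rw [mul_comm]
      exact mul_le_mul_of_nonneg_right (hω t) (hh0 t ω)
    have e4 : H k ω = 1 + ∑ t ∈ Finset.range k, h t ω := rfl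
    have e5 : (1 + N) * ∑ t ∈ Finset.range k, h t ω ≤ (1 + N) * H k ω := by
      rw [e4]; gcongr; linarith
    have e6 := le_abs_self (∑ t ∈ Finset.range k, h t ω * ζ (t + 1) ω)
    change ∑ t ∈ Finset.range k, h t ω * w (t + 1) ω ^ 2 ≤ (2 * B + (1 + N)) * H k ω
    rw [e2]; linarith
  · rw [habs, div_le_one (by linarith [hH1 (t + 1) ω])]
    exact (hh1 t ω).trans (hH1 _ ω)
  · refine le_trans (Finset.sum_le_sum fun t _ => ?_) (sum_sub_div_rpow_le (A := fun k => H k ω)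
      (leverageSum_mono hα _) (leverageSum_zero α _) hγ1 k)
    have h1 := hH1 (t + 1) ω
    rw [habs, hHs, Real.div_rpow (hh0 t ω) (by linarith)]
    gcongr
    simpa using Real.rpow_le_rpow_of_exponent_ge_of_imp (hh0 t ω) (hh1 t ω) hγ1.le
      (fun _ h => absurd h (by linarith))

theorem ae_sum_leverage_mul_sq_le_logNormalizer (hw : BoundedMartingaleNoise P ℱ w β N)
    (hβ : 2 ≤ β) {κ : ℝ} (hκ : 1 < κ) (hα : 0 < α) (hx : ∀ t, Measurable[ℱ t] (x t)) :
    ∀ᵐ ω ∂P, ∃ C, 0 ≤ C ∧ ∀ k,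
      ∑ t ∈ Finset.range k, leverage α (fun t => x t ω) t * w (t + 1) ω ^ 2 ≤
        C * logNormalizer κ (leverageSum α (fun t => x t ω) k) := by
  set H : ℕ → Ω → ℝ := fun k ω => leverageSum α (fun t => x t ω) k with hH
  set h : ℕ → Ω → ℝ := fun k ω => leverage α (fun t => x t ω) k with hh
  have h2 := fun t => hw.lower_moment (s := 2) (by norm_num) hβ t
  simp only [Real.rpow_two, sq_abs] at h2
  have hHs : ∀ t ω, H (t + 1) ω - H t ω = h t ω := fun t ω => leverageSum_sub α _ t
  have hH1 : ∀ t ω, 1 ≤ H t ω := fun t ω => one_le_leverageSum hα _ t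
  have hh0 : ∀ t ω, 0 ≤ h t ω := fun t ω => leverage_nonneg hα _ t
  have hh1 : ∀ t ω, h t ω ≤ 1 := fun t ω => leverage_le_one hα _ t
  have hhm : ∀ t, Measurable[ℱ t] (h t) := fun t =>
    measurable_leverage α fun r hr => (hx r).mono (ℱ.mono hr) le_rfl
  have hlm : Measurable (logNormalizer κ) :=
    measurable_id.mul ((measurable_const.add Real.measurable_log).pow_const κ)
  have hpos : ∀ t ω, 0 < logNormalizer κ (H t ω) := fun t ω => logNormalizer_pos (hH1 t ω)
  have he0 : ∀ t ω, 0 ≤ h t ω / logNormalizer κ (H (t + 1) ω) := fun t ω =>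
    div_nonneg (hh0 t ω) (hpos _ ω).le
  have key := ae_bounded_sum_of_nonneg (P := P) (ℱ := ℱ)
    (e := fun t ω => h t ω / logNormalizer κ (H (t + 1) ω)) (ζ := fun n ω => w n ω ^ 2)
    (N := 1 + N) (K := 1 / (κ - 1))
    (fun t => (hhm t).div (hlm.comp (measurable_leverageSum hx t))) he0
    (fun t ω => ?_) (fun k ω => ?_) (by linarith [hw.nonneg]) (fun t => (h2 t).1)
    (fun t ω => sq_nonneg _) (fun t => (h2 t).2)
  · filter_upwards [key] with ω ⟨B, hB⟩
    refine ⟨B, by simpa using hB 0, fun k => ?_⟩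
    refine le_trans ?_ (mul_le_mul_of_nonneg_right (hB k) (hpos k ω).le)
    rw [Finset.sum_mul]
    refine Finset.sum_le_sum fun t ht => ?_
    have h3 : logNormalizer κ (H (t + 1) ω) ≤ logNormalizer κ (H k ω) :=
      logNormalizer_mono (by linarith) (hH1 _ ω)
        (leverageSum_mono hα _ (Finset.mem_range.1 ht))
    calc h t ω * w (t + 1) ω ^ 2
        = h t ω / logNormalizer κ (H (t + 1) ω) * w (t + 1) ω ^ 2 *
            logNormalizer κ (H (t + 1) ω) := by
          have := hpos (t + 1) ω
          field_simp
      _ ≤ _ := mul_le_mul_of_nonneg_left h3 (mul_nonneg (he0 t ω) (sq_nonneg _))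
  · rw [div_le_one (hpos _ ω)]
    exact (hh1 t ω).trans (one_le_logNormalizer (by linarith) (hH1 _ ω))
  · simp only [← hHs]
    exact sum_sub_div_logNormalizer_le (A := fun k => H k ω) (leverageSum_mono hα _)
      (leverageSum_zero α _) hκ k

theorem ae_scoreEnergy_le (hw : BoundedMartingaleNoise P ℱ w β N) (hβ : 2 < β)
    (hα : 0 < α) (hx : ∀ t, Measurable[ℱ t] (x t)) :
    ∀ᵐ ω ∂P, ∃ C, ∀ k, scoreEnergy α (fun t => x t ω) (fun t => w t ω) k ≤
      C * leverageSum α (fun t => x t ω) k := by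
  filter_upwards [hw.ae_cross_terms_bounded hβ.le hx (α := α),
    hw.ae_sum_leverage_mul_sq_le hβ hα hx] with ω ⟨C₁, h1⟩ ⟨C₂, _, h2⟩
  refine ⟨|C₁| + C₂, fun k => ?_⟩
  have h3 := one_le_leverageSum hα (fun t => x t ω) k
  have h4 : |C₁| ≤ |C₁| * leverageSum α (fun t => x t ω) k :=
    le_mul_of_one_le_right (abs_nonneg _) h3
  linarith [scoreEnergy_le hα (fun t => x t ω) (fun t => w t ω) k, h1 k, h2 k, le_abs_self C₁]

theorem ae_scoreEnergy_le_logNormalizer (hw : BoundedMartingaleNoise P ℱ w β N) (hβ : 2 ≤ β)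
    {κ : ℝ} (hκ : 1 < κ) (hα : 0 < α) (hx : ∀ t, Measurable[ℱ t] (x t)) :
    ∀ᵐ ω ∂P, ∃ C, ∀ k, scoreEnergy α (fun t => x t ω) (fun t => w t ω) k ≤
      C * logNormalizer κ (leverageSum α (fun t => x t ω) k) := by
  filter_upwards [hw.ae_cross_terms_bounded hβ hx (α := α),
    hw.ae_sum_leverage_mul_sq_le_logNormalizer hβ hκ hα hx] with ω ⟨C₁, h1⟩ ⟨C₂, _, h2⟩
  refine ⟨|C₁| + C₂, fun k => ?_⟩
  have h3 := one_le_logNormalizer (κ := κ) (by linarith)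
    (one_le_leverageSum hα (fun t => x t ω) k)
  have h4 : |C₁| ≤ |C₁| * logNormalizer κ (leverageSum α (fun t => x t ω) k) :=
    le_mul_of_one_le_right (abs_nonneg _) h3
  linarith [scoreEnergy_le hα (fun t => x t ω) (fun t => w t ω) k, h1 k, h2 k, le_abs_self C₁]

end BoundedMartingaleNoise

end LeastSquares

namespace LeastSquares

variable {Ω : Type*} {mΩ : MeasurableSpace Ω} {P : Measure Ω} [IsProbabilityMeasure P]
  {ℱ : Filtration ℕ mΩ} {w : ℕ → Ω → ℝ} {β : ℝ}

/-- The event that the conditional `β`-moments have not exceeded `N` up to time `t`. -/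
def momentEvent (P : Measure Ω) (ℱ : Filtration ℕ mΩ) (w : ℕ → Ω → ℝ) (β : ℝ) (N : ℕ) (t : ℕ) :
    Set Ω :=
  {ω | ∀ j ≤ t, condLExp (ℱ j) P (fun ω' => ENNReal.ofReal (|w (j + 1) ω'| ^ β)) ω ≤ N}

theorem measurableSet_momentEvent (N t : ℕ) :
    MeasurableSet[ℱ t] (momentEvent P ℱ w β N t) := by
  have : momentEvent P ℱ w β N t = ⋂ j, ⋂ (_ : j ≤ t),
      {ω | condLExp (ℱ j) P (fun ω' => ENNReal.ofReal (|w (j + 1) ω'| ^ β)) ω ≤ N} := by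
    ext ω; simp [momentEvent]
  rw [this]
  refine MeasurableSet.iInter fun j => MeasurableSet.iInter fun hj => ?_
  exact ℱ.mono hj _ (measurableSet_le (measurable_condLExp _ _ _) measurable_const)

/-- The noise stopped when a conditional `β`-moment exceeds `N`. -/
noncomputable def stoppedNoise (P : Measure Ω) (ℱ : Filtration ℕ mΩ) (w : ℕ → Ω → ℝ) (β : ℝ)
    (N : ℕ) (n : ℕ) : Ω → ℝ :=
  (momentEvent P ℱ w β N (n - 1)).indicator (w n)

theorem boundedMartingaleNoise_stoppedNoise (hw : MPARX.MartingaleNoise P ℱ w β) (hβ : 0 < β)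
    (N : ℕ) : BoundedMartingaleNoise P ℱ (stoppedNoise P ℱ w β N) β N := by
  obtain ⟨hm, hi, h0, -⟩ := hw
  have hB := fun t => measurableSet_momentEvent (P := P) (ℱ := ℱ) (w := w) (β := β) N t
  have hB' := fun t => ℱ.le t _ (hB t)
  have hs : ∀ t, stoppedNoise P ℱ w β N (t + 1) =
      (momentEvent P ℱ w β N t).indicator (w (t + 1)) := fun t => rfl
  have hpow : ∀ t ω, ENNReal.ofReal (|stoppedNoise P ℱ w β N (t + 1) ω| ^ β) =
      (momentEvent P ℱ w β N t).indicator
        (fun ω => ENNReal.ofReal (|w (t + 1) ω| ^ β)) ω := fun t ω => by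
    rw [hs]
    by_cases h : ω ∈ momentEvent P ℱ w β N t
    · simp [h]
    · simp [h, Real.zero_rpow hβ.ne']
  have hsm : ∀ t, Measurable[ℱ (t + 1)] (stoppedNoise P ℱ w β N (t + 1)) := fun t =>
    (hm t).indicator (ℱ.mono t.le_succ _ (hB t))
  have hsm' : ∀ t, Measurable (fun ω => |stoppedNoise P ℱ w β N (t + 1) ω| ^ β) := fun t =>
    (((hsm t).mono (ℱ.le _) le_rfl).abs.pow_const β)
  have hL : ∀ t, ∫⁻ ω, ENNReal.ofReal (|stoppedNoise P ℱ w β N (t + 1) ω| ^ β) ∂P ≤ N := by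
    intro t
    simp only [hpow]
    rw [lintegral_indicator (hB' t), ← setLIntegral_condLExp (ℱ.le t) P _ (hB t)]
    calc _ ≤ ∫⁻ _ in momentEvent P ℱ w β N t, (N : ℝ≥0∞) ∂P :=
          setLIntegral_mono measurable_const fun ω hω => hω t le_rfl
      _ ≤ N := by
          rw [setLIntegral_const]
          exact mul_le_of_le_one_right' prob_le_one
  have hint : ∀ t, Integrable (fun ω => |stoppedNoise P ℱ w β N (t + 1) ω| ^ β) P := fun t => by
    refine ⟨(hsm' t).aestronglyMeasurable, ?_⟩
    rw [hasFiniteIntegral_iff_ofReal (Eventually.of_forall fun ω => by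
      simp only [Pi.zero_apply]; positivity)]
    exact (hL t).trans_lt (ENNReal.natCast_lt_top N)
  refine ⟨hsm, fun t => (hi t).indicator (hB' t), fun t => ?_, hint, fun t => ?_⟩
  · rw [hs]
    refine (condExp_indicator (hi t) (hB t)).trans ?_
    filter_upwards [h0 t] with ω hω
    by_cases h : ω ∈ momentEvent P ℱ w β N t <;> simp [h, hω]
  · have h1 := condLExp_ofReal (ℱ t) (hint t) (Eventually.of_forall fun ω => by
      simp only [Pi.zero_apply]; positivity)
    have h2 : (momentEvent P ℱ w β N t).indicator
        (condLExp (ℱ t) P (fun ω => ENNReal.ofReal (|w (t + 1) ω| ^ β))) =ᵐ[P]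
        condLExp (ℱ t) P (fun ω => ENNReal.ofReal (|stoppedNoise P ℱ w β N (t + 1) ω| ^ β)) := by
      refine ae_eq_condLExp (ℱ.le t) P _ ((measurable_condLExp _ _ _).indicator (hB t)) ?_
      intro s hs
      simp only [hpow]
      rw [setLIntegral_indicator (hB' t), setLIntegral_indicator (hB' t),
        setLIntegral_condLExp (ℱ.le t) P _ ((hB t).inter hs)]
    filter_upwards [h1, h2] with ω h3 h4
    rw [h3] at h4
    have h5 : (momentEvent P ℱ w β N t).indicator
        (condLExp (ℱ t) P (fun ω => ENNReal.ofReal (|w (t + 1) ω| ^ β))) ω ≤ N := by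
      by_cases h : ω ∈ momentEvent P ℱ w β N t
      · simpa [h] using h t le_rfl
      · simp [h]
    rw [h4] at h5
    have := (ENNReal.ofReal_le_iff_le_toReal (ENNReal.natCast_ne_top N)).1 h5
    simpa using this

theorem score_congr {ι : Type*} {x : ℕ → ι → ℝ} {v v' : ℕ → ℝ} (h : ∀ t, v (t + 1) = v' (t + 1))
    (k : ℕ) : score x v k = score x v' k := by
  simp [score, h]

theorem exists_stoppedNoise_eq {ω : Ω}
    (h : (⨆ k, condLExp (ℱ k) P (fun ω' => ENNReal.ofReal (|w (k + 1) ω'| ^ β)) ω) < ∞) :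
    ∃ N : ℕ, ∀ t, stoppedNoise P ℱ w β N (t + 1) ω = w (t + 1) ω := by
  obtain ⟨N, hN⟩ := ENNReal.exists_nat_gt h.ne
  refine ⟨N, fun t => Set.indicator_of_mem ?_ _⟩
  exact fun j _ => (le_iSup (fun k => condLExp (ℱ k) P
    (fun ω' => ENNReal.ofReal (|w (k + 1) ω'| ^ β)) ω) j).trans hN.le

variable {ι : Type*} [Fintype ι] [DecidableEq ι] {α : ℝ} {x : ℕ → Ω → ι → ℝ}

/-- A pathwise bound on the score energy that holds for noises with bounded conditional moments
holds for noises with almost surely finite conditional moments. -/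
theorem ae_scoreEnergy_le_of_stoppedNoise (hw : MPARX.MartingaleNoise P ℱ w β)
    {R : Ω → ℕ → ℝ}
    (h : ∀ N : ℕ, ∀ᵐ ω ∂P, ∃ C, ∀ k, scoreEnergy α (fun t => x t ω)
      (fun t => stoppedNoise P ℱ w β N t ω) k ≤ C * R ω k) :
    ∀ᵐ ω ∂P, ∃ C, ∀ k, scoreEnergy α (fun t => x t ω) (fun t => w t ω) k ≤ C * R ω k := by
  filter_upwards [ae_all_iff.2 h, hw.2.2.2] with ω h1 h2
  obtain ⟨N, hN⟩ := exists_stoppedNoise_eq h2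
  obtain ⟨C, hC⟩ := h1 N
  refine ⟨C, fun k => ?_⟩
  have := hC k
  unfold scoreEnergy at this ⊢
  rwa [score_congr (v' := fun t => w t ω) hN] at this

theorem _root_.MPARX.MartingaleNoise.ae_scoreEnergy_le (hw : MPARX.MartingaleNoise P ℱ w β)
    (hβ : 2 < β) (hα : 0 < α) (hx : ∀ t, Measurable[ℱ t] (x t)) :
    ∀ᵐ ω ∂P, ∃ C, ∀ k, scoreEnergy α (fun t => x t ω) (fun t => w t ω) k ≤
      C * leverageSum α (fun t => x t ω) k :=
  ae_scoreEnergy_le_of_stoppedNoise hw fun N =>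
    (boundedMartingaleNoise_stoppedNoise hw (by linarith) N).ae_scoreEnergy_le hβ hα hx

theorem _root_.MPARX.MartingaleNoise.ae_scoreEnergy_le_logNormalizer
    (hw : MPARX.MartingaleNoise P ℱ w β) (hβ : 2 ≤ β) {κ : ℝ} (hκ : 1 < κ) (hα : 0 < α)
    (hx : ∀ t, Measurable[ℱ t] (x t)) :
    ∀ᵐ ω ∂P, ∃ C, ∀ k, scoreEnergy α (fun t => x t ω) (fun t => w t ω) k ≤
      C * logNormalizer κ (leverageSum α (fun t => x t ω) k) :=
  ae_scoreEnergy_le_of_stoppedNoise hw fun N =>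
    (boundedMartingaleNoise_stoppedNoise hw (by linarith) N).ae_scoreEnergy_le_logNormalizer
      hβ hκ hα hx

end LeastSquares

namespace LeastSquares

theorem measurable_laplace_density (μ b : ℝ) :
    Measurable fun x : ℝ => ENNReal.ofReal (1 / (2 * b) * Real.exp (-|x - μ| / b)) := by
  fun_prop

/-- Shifting a Laplace variable by `d` changes probabilities by a factor of at most
`exp (|d| / b)`. -/
theorem laplaceMeasure_le_shift {b : ℝ} (hb : 0 < b) (d : ℝ) {S : Set ℝ} (hS : MeasurableSet S) :
    MPARX.laplaceMeasure 0 b S ≤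
      ENNReal.ofReal (Real.exp (|d| / b)) * MPARX.laplaceMeasure 0 b ((fun x => x + d) ⁻¹' S) := by
  have hm := measurable_laplace_density 0 b
  have hS' : MeasurableSet ((fun x => x + d) ⁻¹' S) := (measurable_add_const d) hS
  unfold MPARX.laplaceMeasure
  rw [withDensity_apply _ hS, withDensity_apply _ hS', ← lintegral_indicator hS,
    ← lintegral_indicator hS', ← lintegral_const_mul _ (hm.indicator hS'),
    ← lintegral_add_right_eq_self _ d]
  refine lintegral_mono fun x => ?_
  by_cases hx : x + d ∈ S
  · have hx' : x ∈ (fun x => x + d) ⁻¹' S := hx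
    rw [Set.indicator_of_mem hx, Set.indicator_of_mem hx', ← ENNReal.ofReal_mul (by positivity)]
    refine ENNReal.ofReal_le_ofReal ?_
    have h : -|x + d - 0| / b ≤ |d| / b + -|x - 0| / b := by
      rw [← add_div]
      gcongr
      have := abs_sub_abs_le_abs_sub x (-d)
      simp only [sub_neg_eq_add, abs_neg] at this
      simp only [sub_zero]
      linarith
    calc 1 / (2 * b) * Real.exp (-|x + d - 0| / b)
        ≤ 1 / (2 * b) * Real.exp (|d| / b + -|x - 0| / b) := by gcongr
      _ = _ := by rw [Real.exp_add]; ring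
  · have hx' : x ∉ (fun x => x + d) ⁻¹' S := hx
    rw [Set.indicator_of_notMem hx]
    exact zero_le

theorem pow_mul_exp_neg_le {t : ℝ} (ht : 0 ≤ t) (n : ℕ) :
    t ^ n * Real.exp (-t) ≤ n.factorial := by
  have h := Real.pow_div_factorial_le_exp t ht n
  rw [div_le_iff₀ (by positivity)] at h
  rw [Real.exp_neg, ← div_eq_mul_inv, div_le_iff₀ (Real.exp_pos t)]
  linarith

theorem integrable_pow_mul_exp_neg_abs {b : ℝ} (hb : 0 < b) (n : ℕ) :
    Integrable fun x : ℝ => |x| ^ n * Real.exp (-|x| / b) := by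
  refine (integrable_inv_one_add_sq.const_mul
    (n.factorial * b ^ n + (n + 2).factorial * b ^ (n + 2))).mono'
    (by fun_prop : Measurable _).aestronglyMeasurable (Eventually.of_forall fun x => ?_)
  have key : ∀ n : ℕ, |x| ^ n * Real.exp (-|x| / b) ≤ n.factorial * b ^ n := fun n => by
    have h := pow_mul_exp_neg_le (t := |x| / b) (by positivity) n
    rw [div_pow, div_mul_eq_mul_div, div_le_iff₀ (by positivity), ← neg_div] at h
    exact h
  rw [Real.norm_eq_abs, abs_of_nonneg (by positivity), ← div_eq_mul_inv,
    le_div_iff₀ (by positivity)]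
  have h1 := key n
  have h2 := key (n + 2)
  have h3 : |x| ^ (n + 2) = |x| ^ n * x ^ 2 := by rw [pow_add, sq_abs]
  rw [h3] at h2
  linarith

theorem integrable_pow_laplaceMeasure {b : ℝ} (hb : 0 < b) (n : ℕ) :
    Integrable (fun x => |x| ^ n) (MPARX.laplaceMeasure 0 b) := by
  unfold MPARX.laplaceMeasure
  rw [integrable_withDensity_iff (measurable_laplace_density 0 b)
    (Eventually.of_forall fun x => ENNReal.ofReal_lt_top)]
  refine ((integrable_pow_mul_exp_neg_abs hb n).const_mul (1 / (2 * b))).congr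
    (Eventually.of_forall fun x => ?_)
  simp only
  rw [ENNReal.toReal_ofReal (by positivity), sub_zero]
  ring

theorem integral_laplaceMeasure (b : ℝ) :
    ∫ x, x ∂(MPARX.laplaceMeasure 0 b) = 0 := by
  unfold MPARX.laplaceMeasure
  rw [integral_withDensity_eq_integral_toReal_smul (measurable_laplace_density 0 b)
    (Eventually.of_forall fun x => ENNReal.ofReal_lt_top)]
  have h : ∀ g : ℝ → ℝ, (∀ x, g (-x) = -g x) → ∫ x, g x = 0 := fun g hg => by
    have h1 := integral_neg_eq_self g volume
    simp only [hg, integral_neg] at h1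
    linarith
  refine h _ fun x => ?_
  simp [abs_neg]

variable {Ω : Type*} {mΩ : MeasurableSpace Ω} {P : Measure Ω} [IsProbabilityMeasure P]

theorem indepFun_prodMk_right {A B C : Type*} [MeasurableSpace A] [MeasurableSpace B]
    [MeasurableSpace C] {X : Ω → A} {Y : Ω → B} {Z : Ω → C} (hX : Measurable X)
    (hY : Measurable Y) (hZ : Measurable Z) (hXY : IndepFun X Y P)
    (hXYZ : IndepFun (fun ω => (X ω, Y ω)) Z P) : IndepFun X (fun ω => (Y ω, Z ω)) P := by
  have := Measure.isProbabilityMeasure_map (μ := P) hX.aemeasurable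
  have := Measure.isProbabilityMeasure_map (μ := P) hY.aemeasurable
  have := Measure.isProbabilityMeasure_map (μ := P) hZ.aemeasurable
  have hYZ : IndepFun Y Z P := hXYZ.comp measurable_snd measurable_id
  rw [indepFun_iff_map_prod_eq_prod_map_map hX.aemeasurable (hY.prodMk hZ).aemeasurable,
    (indepFun_iff_map_prod_eq_prod_map_map hY.aemeasurable hZ.aemeasurable).1 hYZ,
    ← Measure.prodAssoc_prod,
    ← (indepFun_iff_map_prod_eq_prod_map_map hX.aemeasurable hY.aemeasurable).1 hXY,
    ← (indepFun_iff_map_prod_eq_prod_map_map (hX.prodMk hY).aemeasurable hZ.aemeasurable).1 hXYZ,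
    Measure.map_map MeasurableEquiv.prodAssoc.measurable ((hX.prodMk hY).prodMk hZ)]
  rfl

/-- Shifting an independent Laplace component of a random element. -/
theorem prob_le_of_laplace_shift {W : Type*} [MeasurableSpace W] {X : Ω → ℝ} {Y : Ω → W}
    (hX : Measurable X) (hY : Measurable Y) (hXY : IndepFun X Y P) {b : ℝ} (hb : 0 < b)
    (hlaw : P.map X = MPARX.laplaceMeasure 0 b) (d : ℝ) {E : Set (ℝ × W)} (hE : MeasurableSet E) :
    P {ω | (X ω, Y ω) ∈ E} ≤
      ENNReal.ofReal (Real.exp (|d| / b)) * P {ω | (X ω + d, Y ω) ∈ E} := by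
  have := Measure.isProbabilityMeasure_map (μ := P) hX.aemeasurable
  have := Measure.isProbabilityMeasure_map (μ := P) hY.aemeasurable
  have hmap := (indepFun_iff_map_prod_eq_prod_map_map hX.aemeasurable hY.aemeasurable).1 hXY
  have hsh : Measurable fun z : ℝ × W => (z.1 + d, z.2) := by fun_prop
  have e1 : P {ω | (X ω, Y ω) ∈ E} = ((P.map X).prod (P.map Y)) E := by
    rw [← hmap, Measure.map_apply (hX.prodMk hY) hE]; rfl
  have e2 : P {ω | (X ω + d, Y ω) ∈ E} =
      ((P.map X).prod (P.map Y)) ((fun z : ℝ × W => (z.1 + d, z.2)) ⁻¹' E) := by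
    rw [← hmap, Measure.map_apply (hX.prodMk hY) (hsh hE)]; rfl
  rw [e1, e2, Measure.prod_apply_symm hE, Measure.prod_apply_symm (hsh hE),
    ← lintegral_const_mul _ (measurable_measure_prodMk_right (hsh hE))]
  refine lintegral_mono fun y => ?_
  have hEy : MeasurableSet ((fun x => (x, y)) ⁻¹' E) := measurable_prodMk_right hE
  rw [hlaw]
  exact laplaceMeasure_le_shift hb d hEy

end LeastSquares

namespace MPARX

open LeastSquares

theorem measurable_lag {m : ℕ} (i : Fin m) (k j : ℕ) :
    Measurable fun u : Fin m → ℕ → ℝ => lag (u i) k j := by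
  unfold lag
  split_ifs
  · exact (measurable_pi_apply _).comp (measurable_pi_apply i)
  · exact measurable_const

variable {Ω : Type*} [mΩ : MeasurableSpace Ω] {P : Measure Ω} [IsProbabilityMeasure P]
  {p m : ℕ} {q : Fin m → ℕ}

section Noise

variable {u : Fin m → ℕ → Ω → ℝ} {w : ℕ → Ω → ℝ} {y : ℕ → Ω → ℝ} {η : ℕ → Ω → ℝ}
  {ξ : Fin m → ℕ → Ω → ℝ}

/-- The inputs and the system noise, taken together. -/
def drivers (u : Fin m → ℕ → Ω → ℝ) (w : ℕ → Ω → ℝ) (ω : Ω) : (Fin m → ℕ → ℝ) × (ℕ → ℝ) :=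
  (fun i k => u i k ω, fun k => w (k + 1) ω)

/-- The output noises at the times `k + 1`, `k ∈ S`. -/
def noiseOn (η : ℕ → Ω → ℝ) (S : Finset ℕ) (ω : Ω) : S → ℝ := fun j => η (j + 1) ω

theorem measurable_drivers (hu : ∀ i k, Measurable (u i k)) (hw : ∀ k, Measurable (w (k + 1))) :
    Measurable (drivers u w) :=
  (measurable_pi_iff.2 fun i => measurable_pi_iff.2 fun k => hu i k).prodMk
    (measurable_pi_iff.2 fun k => hw k)

theorem measurable_noiseOn (hη : ∀ k, Measurable (η (k + 1))) (S : Finset ℕ) :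
    Measurable (noiseOn η S) :=
  measurable_pi_iff.2 fun j => hη j

/-- An output noise is independent of the other output noises and the drivers of the system. -/
theorem NoiseIndependence.indepFun_drivers (h : NoiseIndependence P y u w η ξ)
    (hu : ∀ i k, Measurable (u i k)) (hw : ∀ k, Measurable (w (k + 1)))
    (hη : ∀ k, Measurable (η (k + 1))) (hξ : ∀ i k, Measurable (ξ i k))
    {k : ℕ} {S : Finset ℕ} (hk : k ∉ S) :
    IndepFun (η (k + 1)) (fun ω => (noiseOn η S ω, drivers u w ω)) P := by
  obtain ⟨h1, h2⟩ := h
  have hm : ∀ s, Measurable (noiseFamily η ξ s) := by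
    rintro ⟨_ | i, j⟩
    · exact hη j
    · exact hξ i j
  have hinj : Function.Injective fun k : ℕ => ((none : Option (Fin m)), k) :=
    fun _ _ h => (Prod.mk.inj h).2
  have hone : iIndepFun (fun k : ℕ => η (k + 1)) P := h1.precomp hinj
  have hXY : IndepFun (η (k + 1)) (noiseOn η S) P := by
    have := hone.indepFun_finset {k} S (Finset.disjoint_singleton_left.2 hk) hη
    exact this.comp (φ := fun f : ({k} : Finset ℕ) → ℝ => f ⟨k, Finset.mem_singleton_self k⟩)
      (ψ := id) (measurable_pi_apply _) measurable_id
  have hXYZ : IndepFun (fun ω => (η (k + 1) ω, noiseOn η S ω)) (drivers u w) P := by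
    have hφ : Measurable fun f : Option (Fin m) × ℕ → ℝ =>
        (f (none, k), fun j : S => f (none, (j : ℕ))) :=
      (measurable_pi_apply (none, k)).prodMk
        (measurable_pi_iff.2 fun j : S => measurable_pi_apply (none, (j : ℕ)))
    exact h2.comp hφ measurable_snd
  exact indepFun_prodMk_right (hη k) (measurable_noiseOn hη S) (measurable_drivers hu hw) hXY hXYZ

end Noise

section Privacy

variable {u : Fin m → ℕ → Ω → ℝ} {w : ℕ → Ω → ℝ} {y : ℕ → Ω → ℝ} {η : ℕ → Ω → ℝ}
  {ξ : Fin m → ℕ → Ω → ℝ} {b : ∀ i : Fin m, Fin (q i) → ℝ}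

theorem outputFrom_zero_order (a : Fin 0 → ℝ) (b : ∀ i : Fin m, Fin (q i) → ℝ)
    (u : Fin m → ℕ → ℝ) (w : ℕ → ℝ) {T : ℕ} (x : Fin T → ℝ) (k : ℕ) :
    outputFrom a b u w x (k + 1) = if h : k < T then x ⟨k, h⟩ else
      (∑ i : Fin m, ∑ l : Fin (q i), b i l * lag (u i) k l) + w (k + 1) := by
  rw [outputFrom]; simp

theorem measurable_generated (b : ∀ i : Fin m, Fin (q i) → ℝ) (k : ℕ) :
    Measurable fun z : (Fin m → ℕ → ℝ) × (ℕ → ℝ) =>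
      (∑ i : Fin m, ∑ l : Fin (q i), b i l * lag (z.1 i) k l) + z.2 k := by
  refine Measurable.add (Finset.measurable_fun_sum _ fun i _ => Finset.measurable_fun_sum _
    fun l _ => ?_) ((measurable_pi_apply k).comp measurable_snd)
  exact ((measurable_lag i k l).comp measurable_fst).const_mul (b i l)

/-- The messages with the noise at the `i`-th time removed, as a function of the other noises and
of the drivers of the system. -/
noncomputable def residualMessage (b : ∀ i : Fin m, Fin (q i) → ℝ) {T₁ T₂ : ℕ} (x : Fin T₁ → ℝ)
    (i : ℕ) (z : ((Finset.range T₂).erase i → ℝ) × (Fin m → ℕ → ℝ) × (ℕ → ℝ)) : Fin T₂ → ℝ :=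
  fun k => (if h : (k : ℕ) < T₁ then x ⟨k, h⟩ else
      (∑ i : Fin m, ∑ l : Fin (q i), b i l * lag (z.2.1 i) k l) + z.2.2 k) +
    if h : (k : ℕ) = i then 0 else z.1 ⟨k, by simp [h]⟩

theorem measurable_residualMessage (b : ∀ i : Fin m, Fin (q i) → ℝ) {T₁ T₂ : ℕ} (x : Fin T₁ → ℝ)
    (i : ℕ) : Measurable (residualMessage b x i (T₂ := T₂)) := by
  refine measurable_pi_iff.2 fun k => Measurable.add ?_ ?_
  · split_ifs
    · exact measurable_const
    · exact (measurable_generated b k).comp measurable_snd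
  · split_ifs
    · exact measurable_const
    · exact (measurable_pi_apply _).comp measurable_fst

theorem outputMechanism_eq (a : Fin 0 → ℝ) {T₁ T₂ : ℕ} (x : Fin T₁ → ℝ) (i : Fin T₂) (ω : Ω) :
    outputMechanism a b u w η T₁ T₂ x ω =
      residualMessage b x i (noiseOn η ((Finset.range T₂).erase i) ω, drivers u w ω) +
        Pi.single i (η (i + 1) ω) := by
  ext k
  simp only [outputMechanism, perturbedOutput, outputFrom_zero_order, residualMessage, drivers,
    noiseOn, Pi.add_apply, add_assoc]
  congr 1
  by_cases h : k = i
  · subst h; simp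
  · have h' : (k : ℕ) ≠ i := fun e => h (Fin.ext e)
    simp [h, h']

theorem residualMessage_update {T₁ T₂ : ℕ} (hT : T₁ ≤ T₂) (x : Fin T₁ → ℝ) (i : Fin T₁) (v : ℝ)
    (z : ((Finset.range T₂).erase i → ℝ) × (Fin m → ℕ → ℝ) × (ℕ → ℝ)) :
    residualMessage b (Function.update x i v) i z =
      residualMessage b x i z + Pi.single (Fin.castLE hT i) (v - x i) := by
  ext k
  simp only [residualMessage, Pi.add_apply]
  by_cases h : k = Fin.castLE hT i
  · subst h; simp
  · have h' : (k : ℕ) ≠ i := fun e => h (Fin.ext e)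
    by_cases hk : (k : ℕ) < T₁
    · have : (⟨k, hk⟩ : Fin T₁) ≠ i := fun e => h' (congrArg Fin.val e)
      simp [h, hk, this]
    · simp [h, hk]

theorem prob_outputMechanism_update (h : NoiseIndependence P y u w η ξ)
    (hu : ∀ i k, Measurable (u i k)) (hw : ∀ k, Measurable (w (k + 1)))
    (hη : ∀ k, Measurable (η (k + 1))) (hξ : ∀ i k, Measurable (ξ i k))
    {b₀ : ℝ} (hb₀ : 0 < b₀) (hLap : ∀ k, P.map (η (k + 1)) = laplaceMeasure 0 b₀)
    (a : Fin 0 → ℝ) {T₁ T₂ : ℕ} (hT : T₁ ≤ T₂) (x : Fin T₁ → ℝ) (i : Fin T₁) (v : ℝ)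
    {D : Set (Fin T₂ → ℝ)} (hD : MeasurableSet D) :
    P {ω | outputMechanism a b u w η T₁ T₂ x ω ∈ D} ≤
      ENNReal.ofReal (Real.exp (|x i - v| / b₀)) *
        P {ω | outputMechanism a b u w η T₁ T₂ (Function.update x i v) ω ∈ D} := by
  set S := (Finset.range T₂).erase i
  set Y : Ω → (S → ℝ) × (Fin m → ℕ → ℝ) × (ℕ → ℝ) := fun ω => (noiseOn η S ω, drivers u w ω)
  have hY : Measurable Y := (measurable_noiseOn hη S).prodMk (measurable_drivers hu hw)
  have hind : IndepFun (η (i + 1)) Y P :=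
    h.indepFun_drivers hu hw hη hξ (Finset.notMem_erase (i : ℕ) (Finset.range T₂))
  set j : Fin T₂ := Fin.castLE hT i
  have hsingle : Measurable fun t : ℝ => (Pi.single j t : Fin T₂ → ℝ) :=
    measurable_pi_iff.2 fun k => by
      by_cases hk : k = j
      · subst hk; simp only [Pi.single_eq_same]; exact measurable_id
      · simp [hk]
  set Φ : ℝ × ((S → ℝ) × (Fin m → ℕ → ℝ) × (ℕ → ℝ)) → Fin T₂ → ℝ :=
    fun z => residualMessage b x i z.2 + Pi.single j z.1
  have hΦ : Measurable Φ :=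
    ((measurable_residualMessage b x i).comp measurable_snd).add (hsingle.comp measurable_fst)
  have key := prob_le_of_laplace_shift (hη i) hY hind hb₀ (hLap i) (v - x i) (hΦ hD)
  have e1 : ∀ ω, outputMechanism a b u w η T₁ T₂ x ω = Φ (η (i + 1) ω, Y ω) := fun ω =>
    outputMechanism_eq a x j ω
  have e2 : ∀ ω, outputMechanism a b u w η T₁ T₂ (Function.update x i v) ω =
      Φ (η (i + 1) ω + (v - x i), Y ω) := fun ω => by
    rw [outputMechanism_eq a _ j ω]
    have := residualMessage_update (b := b) hT x i v (Y ω)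
    change residualMessage b (Function.update x i v) i (Y ω) + Pi.single j (η (i + 1) ω) = _
    rw [this, add_assoc, ← Pi.single_add, add_comm (v - x i)]
  rw [abs_sub_comm]
  simp only [e1, e2]
  exact key

theorem outputPrivate_of_zero_order (h : NoiseIndependence P y u w η ξ)
    (hu : ∀ i k, Measurable (u i k)) (hw : ∀ k, Measurable (w (k + 1)))
    (hη : ∀ k, Measurable (η (k + 1))) (hξ : ∀ i k, Measurable (ξ i k))
    {b₀ : ℝ} (hb₀ : 0 < b₀) (hLap : ∀ k, P.map (η (k + 1)) = laplaceMeasure 0 b₀)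
    (a : Fin 0 → ℝ) {ε δ : ℝ} (hscale : δ / b₀ ≤ ε) :
    OutputPrivate P a b u w η ε δ := by
  intro T₁ T₂ _ hT x x' hxx D hD
  have key : ∀ s : Finset (Fin T₁), P {ω | outputMechanism a b u w η T₁ T₂ x ω ∈ D} ≤
      ENNReal.ofReal (Real.exp ((∑ i ∈ s, |x i - x' i|) / b₀)) *
        P {ω | outputMechanism a b u w η T₁ T₂ (s.piecewise x' x) ω ∈ D} := by
    intro s
    induction s using Finset.induction_on with
    | empty => simp
    | insert i s his ih =>
      refine ih.trans ?_
      have h1 := prob_outputMechanism_update (b := b) h hu hw hη hξ hb₀ hLap a hT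
        (s.piecewise x' x) i (x' i) hD
      rw [Finset.piecewise_eq_of_notMem _ _ _ his, ← Finset.piecewise_insert] at h1
      refine (mul_le_mul_right h1 _).trans (le_of_eq ?_)
      rw [← mul_assoc, ← ENNReal.ofReal_mul (by positivity), ← Real.exp_add, ← add_div,
        Finset.sum_insert his, add_comm (|x i - x' i|)]
  have h1 := key Finset.univ
  rw [Finset.piecewise_univ] at h1
  refine h1.trans ?_
  gcongr
  refine le_trans ?_ hscale
  gcongr
  exact hxx

end Privacy

end MPARX

namespace MPARX

open LeastSquares

section Algebra

variable {p m : ℕ} {q : Fin m → ℕ}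

theorem rlsState_snd {α : ℝ} (hα : 0 < α) (θ₀ : Idx p q → ℝ) (yb : ℕ → ℝ)
    (ub : Fin m → ℕ → ℝ) (k : ℕ) :
    (rlsState α θ₀ yb ub k).2 = (infoMatrix α (regressor p q yb ub) k)⁻¹ := by
  induction k with
  | zero =>
    rw [rlsState, infoMatrix, Finset.sum_range_zero, add_zero]
    symm
    apply Matrix.inv_eq_right_inv
    rw [smul_mul_smul_comm, mul_inv_cancel₀ hα.ne', mul_one, one_smul]
  | succ k ih => rw [rlsState, infoMatrix_succ, inv_add_vecMulVec (posDef_infoMatrix hα _ k), ih]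

theorem gainInv_eq {α : ℝ} (hα : 0 < α) (θ₀ : Idx p q → ℝ) (yb : ℕ → ℝ)
    (ub : Fin m → ℕ → ℝ) (k : ℕ) :
    gainInv α θ₀ yb ub k = infoMatrix α (regressor p q yb ub) k := by
  rw [gainInv, rlsState_snd hα, Matrix.nonsing_inv_nonsing_inv _ (isUnit_det_infoMatrix hα _ k)]

/-- The normal equations satisfied by the estimation error. -/
theorem infoMatrix_mulVec_error {α : ℝ} (hα : 0 < α) (θ₀ θ : Idx p q → ℝ) (yb v : ℕ → ℝ)
    (ub : Fin m → ℕ → ℝ) (hv : ∀ k, yb (k + 1) = regressor p q yb ub k ⬝ᵥ θ + v (k + 1)) (k : ℕ) :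
    infoMatrix α (regressor p q yb ub) k *ᵥ (estimate α θ₀ yb ub k - θ) =
      α • (θ₀ - θ) + score (regressor p q yb ub) v k := by
  induction k with
  | zero => simp [estimate, rlsState, infoMatrix, score, Matrix.smul_mulVec]
  | succ k ih =>
    set x := regressor p q yb ub with hx
    set V := infoMatrix α x k
    have hV : V.PosDef := posDef_infoMatrix hα x k
    have hc := quadratic_inv_nonneg hV (x k)
    have hVV : V *ᵥ (V⁻¹ *ᵥ x k) = x k := by
      rw [Matrix.mulVec_mulVec, Matrix.mul_nonsing_inv _ hV.det_pos.ne'.isUnit, Matrix.one_mulVec]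
    have hst : estimate α θ₀ yb ub (k + 1) = estimate α θ₀ yb ub k +
        ((1 + x k ⬝ᵥ (V⁻¹ *ᵥ x k))⁻¹ * (yb (k + 1) - x k ⬝ᵥ estimate α θ₀ yb ub k)) •
          (V⁻¹ *ᵥ x k) := by
      rw [estimate, rlsState, rlsState_snd hα]; rfl
    set e := estimate α θ₀ yb ub k
    set c := x k ⬝ᵥ (V⁻¹ *ᵥ x k)
    rw [hst, infoMatrix_succ, score_succ, ← add_assoc, ← ih, add_sub_right_comm, Matrix.mulVec_add,
      Matrix.mulVec_smul, Matrix.add_mulVec, Matrix.add_mulVec, Matrix.vecMulVec_mulVec,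
      Matrix.vecMulVec_mulVec, hVV, hv k]
    have h1 : (1 + c) ≠ 0 := by positivity
    ext i
    simp only [Pi.add_apply, Pi.smul_apply, MulOpposite.smul_eq_mul_unop, MulOpposite.unop_op,
      smul_eq_mul, dotProduct_sub]
    field_simp
    ring

variable {ι : Type*} [Fintype ι] [DecidableEq ι]

theorem quadratic_inv_add_le {V : Matrix ι ι ℝ} (hV : V.PosDef) (y z : ι → ℝ) :
    (y + z) ⬝ᵥ (V⁻¹ *ᵥ (y + z)) ≤ 2 * (y ⬝ᵥ (V⁻¹ *ᵥ y)) + 2 * (z ⬝ᵥ (V⁻¹ *ᵥ z)) := by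
  have h := quadratic_inv_nonneg hV (y - z)
  simp only [Matrix.mulVec_add, Matrix.mulVec_sub, dotProduct_add, add_dotProduct,
    dotProduct_sub, sub_dotProduct] at h ⊢
  linarith

theorem quadratic_inv_infoMatrix_le {α : ℝ} (hα : 0 < α) (x : ℕ → ι → ℝ) (z : ι → ℝ) (k : ℕ) :
    z ⬝ᵥ ((infoMatrix α x k)⁻¹ *ᵥ z) ≤ z ⬝ᵥ ((infoMatrix α x 0)⁻¹ *ᵥ z) := by
  induction k with
  | zero => exact le_rfl
  | succ k ih =>
    have hc := quadratic_inv_nonneg (posDef_infoMatrix hα x k) (x k)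
    rw [infoMatrix_succ, quadratic_inv_add_vecMulVec (posDef_infoMatrix hα x k)]
    have : 0 ≤ (1 + x k ⬝ᵥ ((infoMatrix α x k)⁻¹ *ᵥ x k))⁻¹ *
      (x k ⬝ᵥ ((infoMatrix α x k)⁻¹ *ᵥ z)) ^ 2 := by positivity
    linarith

theorem score_add (x : ℕ → ι → ℝ) (v v' : ℕ → ℝ) (k : ℕ) :
    score x (v + v') k = score x v k + score x v' k := by
  simp [score, add_smul, Finset.sum_add_distrib]

/-- The error in normal equations is controlled by the smallest eigenvalue of the information
matrix and by the score energies. -/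
theorem lambdaMin_mul_error_le {α : ℝ} (hα : 0 < α) (x : ℕ → ι → ℝ) (v v' : ℕ → ℝ) (z e : ι → ℝ)
    (k : ℕ) (he : infoMatrix α x k *ᵥ e = z + score x (v + v') k) :
    lambdaMin (infoMatrix α x k) * (e ⬝ᵥ e) ≤ 2 * (z ⬝ᵥ ((infoMatrix α x 0)⁻¹ *ᵥ z)) +
      4 * scoreEnergy α x v k + 4 * scoreEnergy α x v' k := by
  have hV := posDef_infoMatrix hα x k
  refine (lambdaMin_mul_le hV.isHermitian e).trans ?_
  have h1 : e = (infoMatrix α x k)⁻¹ *ᵥ (infoMatrix α x k *ᵥ e) := by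
    rw [Matrix.mulVec_mulVec, Matrix.nonsing_inv_mul _ hV.det_pos.ne'.isUnit, Matrix.one_mulVec]
  have h2 : e ⬝ᵥ (infoMatrix α x k *ᵥ e) = (infoMatrix α x k *ᵥ e) ⬝ᵥ
      ((infoMatrix α x k)⁻¹ *ᵥ (infoMatrix α x k *ᵥ e)) := by
    rw [← h1, dotProduct_comm]
  rw [h2, he, score_add]
  have h3 := quadratic_inv_add_le hV z (score x v k + score x v' k)
  have h4 := quadratic_inv_add_le hV (score x v k) (score x v' k)
  have h5 := quadratic_inv_infoMatrix_le hα x z k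
  unfold scoreEnergy
  linarith

end Algebra

section Rates

theorem logNormalizer_mul_le {κ C L : ℝ} (hκ : 0 ≤ κ) (hC : 1 ≤ C) (hL : 1 ≤ L) :
    logNormalizer κ (C * L) ≤
      C * (2 + Real.log C) ^ κ * (L * Real.log (Real.exp 1 + L) ^ κ) := by
  have hC0 := Real.log_nonneg hC
  have hL0 := Real.log_nonneg hL
  have he := Real.exp_pos 1
  have h1 : Real.log L ≤ Real.log (Real.exp 1 + L) := Real.log_le_log (by linarith) (by linarith)
  have h2 : 1 ≤ Real.log (Real.exp 1 + L) := by
    rw [Real.le_log_iff_exp_le (by linarith)]; linarith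
  have h3 : 1 + Real.log (C * L) ≤ (2 + Real.log C) * Real.log (Real.exp 1 + L) := by
    rw [Real.log_mul (by linarith) (by linarith)]
    nlinarith
  have h4 : 0 ≤ 1 + Real.log (C * L) := by
    rw [Real.log_mul (by linarith) (by linarith)]; linarith
  unfold logNormalizer
  calc C * L * (1 + Real.log (C * L)) ^ κ
      ≤ C * L * ((2 + Real.log C) * Real.log (Real.exp 1 + L)) ^ κ := by
        gcongr
    _ = _ := by rw [Real.mul_rpow (by linarith) (by linarith)]; ring

theorem log_le_excitationRate {β κ r : ℝ} (hκ : 0 ≤ κ) (hr : 1 ≤ Real.log r) :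
    Real.log r ≤ excitationRate β κ r := by
  unfold excitationRate
  split_ifs
  · have h2 : 1 ≤ Real.log (Real.exp 1 + Real.log r) := by
      rw [Real.le_log_iff_exp_le (by positivity)]; linarith
    exact le_mul_of_one_le_right (by linarith) (Real.one_le_rpow h2 hκ)
  · exact le_rfl

theorem one_le_log_energy (p : ℕ) {m : ℕ} (q : Fin m → ℕ) (yb : ℕ → ℝ) (ub : Fin m → ℕ → ℝ)
    (k : ℕ) : 1 ≤ Real.log (energy p q yb ub k) := by
  have hs : 0 ≤ ∑ t ∈ Finset.range (k + 1), regressor p q yb ub t ⬝ᵥ regressor p q yb ub t :=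
    Finset.sum_nonneg fun t _ => by simpa using dotProduct_star_self_nonneg (regressor p q yb ub t)
  have := Real.exp_pos 1
  unfold energy
  rw [Real.le_log_iff_exp_le (by linarith)]
  linarith

theorem exists_leverageSum_le_log_energy {α : ℝ} (hα : 0 < α) (p : ℕ) {m : ℕ} (q : Fin m → ℕ)
    (yb : ℕ → ℝ) (ub : Fin m → ℕ → ℝ) :
    ∃ C : ℝ, 1 ≤ C ∧ ∀ k, leverageSum α (regressor p q yb ub) (k + 1) ≤
      C * Real.log (energy p q yb ub k) := by
  obtain ⟨C, hC0, hC⟩ := exists_sum_leverage_le hα (regressor p q yb ub)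
  refine ⟨1 + C, by linarith, fun k => ?_⟩
  have h1 := one_le_log_energy p q yb ub k
  have h2 := hC (k + 1)
  change _ ≤ C * Real.log (energy p q yb ub k) at h2
  unfold leverageSum
  linarith

end Rates

/-- A vector sequence tends to zero if its squared length, weighted by a divergent sequence, is
dominated by a sequence that is negligible with respect to the weights. -/
theorem tendsto_of_mul_dotProduct_le {ι : Type*} [Fintype ι] {e : ℕ → ι → ℝ} {l r : ℕ → ℝ}
    {A B : ℝ} (hl : Tendsto l atTop atTop) (hr : Tendsto (fun k => r k / l k) atTop (𝓝 0))
    (h : ∀ k, l k * (e k ⬝ᵥ e k) ≤ A + B * r k) : Tendsto e atTop (𝓝 0) := by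
  have h0 : Tendsto (fun k => A / l k + B * (r k / l k)) atTop (𝓝 0) := by
    simpa using (hl.const_div_atTop A).add (hr.const_mul B)
  have hnn : ∀ k, 0 ≤ e k ⬝ᵥ e k := fun k => by simpa using dotProduct_star_self_nonneg (e k)
  have h1 : Tendsto (fun k => e k ⬝ᵥ e k) atTop (𝓝 0) := by
    refine squeeze_zero' (Eventually.of_forall hnn) ?_ h0
    filter_upwards [hl.eventually_gt_atTop 0] with k hk
    rw [← mul_div_assoc, ← add_div, le_div_iff₀ hk, mul_comm]
    exact h k
  rw [tendsto_pi_nhds]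
  intro i
  have h2 : Tendsto (fun k => √(e k ⬝ᵥ e k)) atTop (𝓝 0) := by
    simpa using h1.sqrt
  refine squeeze_zero_norm (fun k => ?_) h2
  rw [Real.norm_eq_abs, ← Real.sqrt_sq_eq_abs]
  refine Real.sqrt_le_sqrt ?_
  rw [sq, dotProduct]
  exact Finset.single_le_sum (f := fun j => e k j * e k j) (fun j _ => mul_self_nonneg _)
    (Finset.mem_univ i)

section LaplaceNoise

variable {Ω : Type*} [mΩ : MeasurableSpace Ω] {P : Measure Ω} [IsProbabilityMeasure P]
  {m : ℕ} {u : Fin m → ℕ → Ω → ℝ} {w : ℕ → Ω → ℝ} {y : ℕ → Ω → ℝ} {η : ℕ → Ω → ℝ}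
  {ξ : Fin m → ℕ → Ω → ℝ}

/-- The filtration generated by the past output noises and the drivers of the system. -/
def noiseFiltration (hu : ∀ i k, Measurable (u i k)) (hw : ∀ k, Measurable (w (k + 1)))
    (hη : ∀ k, Measurable (η (k + 1))) : Filtration ℕ mΩ where
  seq k := MeasurableSpace.comap
    (fun ω => (noiseOn η (Finset.range k) ω, drivers u w ω)) inferInstance
  mono' k l hkl := by
    have hr : Measurable fun z : (Finset.range l → ℝ) × (Fin m → ℕ → ℝ) × (ℕ → ℝ) =>
        ((fun j : Finset.range k => z.1 ⟨j, Finset.range_mono hkl j.2⟩), z.2) :=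
      (measurable_pi_iff.2 fun j => (measurable_pi_apply _).comp measurable_fst).prodMk
        measurable_snd
    have e : (fun ω => (noiseOn η (Finset.range k) ω, drivers u w ω)) =
        (fun z : (Finset.range l → ℝ) × (Fin m → ℕ → ℝ) × (ℕ → ℝ) =>
          ((fun j : Finset.range k => z.1 ⟨j, Finset.range_mono hkl j.2⟩), z.2)) ∘
        fun ω => (noiseOn η (Finset.range l) ω, drivers u w ω) := rfl
    simp only
    rw [e, ← MeasurableSpace.comap_comp]
    exact MeasurableSpace.comap_mono hr.comap_le
  le' k := ((measurable_noiseOn hη _).prodMk (measurable_drivers hu hw)).comap_le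

theorem measurable_noiseFiltration_of_drivers (hu : ∀ i k, Measurable (u i k))
    (hw : ∀ k, Measurable (w (k + 1))) (hη : ∀ k, Measurable (η (k + 1))) {E : Type*}
    [MeasurableSpace E] {f : (Fin m → ℕ → ℝ) × (ℕ → ℝ) → E} (hf : Measurable f) (k : ℕ) :
    Measurable[noiseFiltration hu hw hη k] (fun ω => f (drivers u w ω)) :=
  (hf.comp measurable_snd).comp (comap_measurable
    (fun ω => (noiseOn η (Finset.range k) ω, drivers u w ω)))

theorem boundedMartingaleNoise_laplace (h : NoiseIndependence P y u w η ξ)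
    (hu : ∀ i k, Measurable (u i k)) (hw : ∀ k, Measurable (w (k + 1)))
    (hη : ∀ k, Measurable (η (k + 1))) (hξ : ∀ i k, Measurable (ξ i k))
    {b₀ : ℝ} (hb₀ : 0 < b₀) (hLap : ∀ k, P.map (η (k + 1)) = laplaceMeasure 0 b₀) :
    BoundedMartingaleNoise P (noiseFiltration hu hw hη) η 4
      (∫ x, |x| ^ 4 ∂(laplaceMeasure 0 b₀)) := by
  have hcond : ∀ t, ∀ f : ℝ → ℝ, Measurable f →
      P[fun ω => f (η (t + 1) ω)|noiseFiltration hu hw hη t] =ᵐ[P]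
        fun _ => ∫ x, f x ∂(laplaceMeasure 0 b₀) := fun t f hf => by
    have hind := h.indepFun_drivers hu hw hη hξ (k := t) (S := Finset.range t) (by simp)
    have h1 := condExp_indep_eq (f := fun ω => f (η (t + 1) ω)) (hη t).comap_le
      ((noiseFiltration hu hw hη).le t)
      (hf.comp (comap_measurable (η (t + 1)))).stronglyMeasurable hind
    rw [← hLap t, integral_map (hη t).aemeasurable hf.aestronglyMeasurable]
    exact h1
  have hint : ∀ t (n : ℕ), Integrable (fun ω => |η (t + 1) ω| ^ n) P := fun t n => by
    have h1 := integrable_pow_laplaceMeasure hb₀ n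
    rw [← hLap t] at h1
    exact (integrable_map_measure (by fun_prop : Measurable _).aestronglyMeasurable
      (hη t).aemeasurable).1 h1
  have e4 : ∀ z : ℝ, |z| ^ (4 : ℝ) = |z| ^ 4 := fun z => by
    rw [← Real.rpow_natCast]; norm_num
  refine ⟨fun t => ?_, fun t => ?_, fun t => ?_, fun t => ?_, fun t => ?_⟩
  · exact ((measurable_pi_apply (⟨t, by simp⟩ : Finset.range (t + 1))).comp measurable_fst).comp
      (comap_measurable (fun ω => (noiseOn η (Finset.range (t + 1)) ω, drivers u w ω)))
  · have h1 := hint t 1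
    simp only [pow_one] at h1
    exact (integrable_norm_iff (hη t).aestronglyMeasurable).1 h1
  · have h1 := hcond t id measurable_id
    simp only [id, integral_laplaceMeasure] at h1
    exact h1
  · simp only [e4]; exact hint t 4
  · simp only [e4]
    filter_upwards [hcond t (fun x => |x| ^ 4) (by fun_prop)] with ω hω
    exact hω.le

end LaplaceNoise

end MPARX

namespace MPARX

open LeastSquares

theorem regressor_zero_order {m : ℕ} (q : Fin m → ℕ) (y y' : ℕ → ℝ) (u : Fin m → ℕ → ℝ) :
    regressor 0 q y u = regressor 0 q y' u := by
  funext k s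
  rcases s with j | s
  · exact j.elim0
  · rfl

theorem ybProc_zero_order_succ {Ω : Type*} {m : ℕ} {q : Fin m → ℕ} (a : Fin 0 → ℝ)
    (b : ∀ i : Fin m, Fin (q i) → ℝ) (u : Fin m → ℕ → Ω → ℝ) (w η : ℕ → Ω → ℝ) (ω : Ω)
    (y : ℕ → ℝ) (k : ℕ) :
    ybProc a b u w η ω (k + 1) =
      regressor 0 q y (fun i j => u i j ω) k ⬝ᵥ paramVec a b + (w (k + 1) ω + η (k + 1) ω) := by
  rw [ybProc, perturbedOutput, yProc, output, outputFrom_zero_order]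
  simp [dotProduct, regressor, paramVec, Fintype.sum_sigma, mul_comm, add_assoc]

end MPARX

open MPARX LeastSquares

theorem theorem5 {Ω : Type*} [mΩ : MeasurableSpace Ω] (P : Measure Ω) [IsProbabilityMeasure P]
    -- the system: orders, true parameters, inputs, system noise
    {p m : ℕ} {q : Fin m → ℕ} (a : Fin p → ℝ) (b : ∀ i : Fin m, Fin (q i) → ℝ)
    (u : Fin m → ℕ → Ω → ℝ) (w : ℕ → Ω → ℝ)
    (hu : ∀ i k, Measurable (u i k)) (hw : ∀ k, Measurable (w (k + 1)))
    -- the privacy noises and the initialisation of the algorithm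
    (η : ℕ → Ω → ℝ) (ξ : Fin m → ℕ → Ω → ℝ) (hη : ∀ k, Measurable (η (k + 1)))
    (b₀ : ℝ) (hb₀ : 0 < b₀) (hLap : ∀ k, P.map (η (k + 1)) = MPARX.laplaceMeasure 0 b₀)
    (α : ℝ) (hα : 0 < α) (θ₀ : MPARX.Idx p q → ℝ)
    -- no autoregressive terms, no input noise
    (hp : p = 0) (hξ : ∀ i k ω, ξ i k ω = 0)
    -- stability
    (hstable : MPARX.AsymptoticallyStable a)
    -- independence of the privacy noises
    (hindep : MPARX.NoiseIndependence P (fun k ω => MPARX.yProc a b u w ω k) u w η ξ)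
    -- martingale difference noise and adapted regressors
    (ℱ : Filtration ℕ mΩ) (β : ℝ) (hβ : 2 ≤ β) (hmart : MPARX.MartingaleNoise P ℱ w β)
    (hadapt : ∀ k, Measurable[ℱ k]
      (fun ω => MPARX.regressor p q (MPARX.yProc a b u w ω) (fun i j => u i j ω) k))
    -- choice of the scale of the output noise
    (ε δ : ℝ) (hε : 0 < ε) (hδ : 0 < δ) (c₀ lam : ℝ) (hdecay : MPARX.DecayBound a c₀ lam)
    (hscale : MPARX.privacyConst p c₀ lam / b₀ * δ ≤ ε)
    -- excitation
    (κ : ℝ) (hκ : 1 < κ)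
    (hexc : ∀ᵐ ω ∂P, Tendsto (fun k =>
      MPARX.excitationRate β κ
          (MPARX.energy p q (MPARX.ybProc a b u w η ω) (MPARX.ubProc u ξ ω) k) /
        MPARX.lambdaMin
          (MPARX.gainInv α θ₀ (MPARX.ybProc a b u w η ω) (MPARX.ubProc u ξ ω) (k + 1)))
      atTop (𝓝 0))
    (hmin : ∀ᵐ ω ∂P, Tendsto (fun k =>
      MPARX.lambdaMin
        (MPARX.gainInv α θ₀ (MPARX.ybProc a b u w η ω) (MPARX.ubProc u ξ ω) k))
      atTop atTop) :
    MPARX.OutputPrivate P a b u w η ε δ ∧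
    ∀ᵐ ω ∂P, Tendsto (fun k =>
      MPARX.estimate α θ₀ (MPARX.ybProc a b u w η ω) (MPARX.ubProc u ξ ω) k)
      atTop (𝓝 (MPARX.paramVec a b)) := by
  subst hp
  have hξm : ∀ i k, Measurable (ξ i k) := fun i k => by
    have : ξ i k = fun _ => 0 := funext fun ω => hξ i k ω
    rw [this]; exact measurable_const
  refine ⟨outputPrivate_of_zero_order hindep hu hw hη hξm hb₀ hLap a ?_, ?_⟩
  · have : privacyConst 0 c₀ lam = 1 := by simp [privacyConst]
    rwa [this, div_mul_eq_mul_div, one_mul] at hscale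
  set x : ℕ → Ω → Idx 0 q → ℝ :=
    fun k ω => regressor 0 q (yProc a b u w ω) (fun i j => u i j ω) k with hx
  have hreg : ∀ ω, regressor 0 q (ybProc a b u w η ω) (ubProc u ξ ω) = fun t => x t ω := fun ω => by
    have hub : ubProc u ξ ω = fun i j => u i j ω := by
      funext i j
      simp [ubProc, perturbedInput, hξ]
    rw [hub, regressor_zero_order q _ (yProc a b u w ω)]
  have hbound : ∀ᵐ ω ∂P, ∃ C, ∀ k, scoreEnergy α (fun t => x t ω) (fun t => w t ω) (k + 1) ≤
      C * excitationRate β κ (energy 0 q (ybProc a b u w η ω) (ubProc u ξ ω) k) := by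
    by_cases hβ2 : β = 2
    · filter_upwards [hmart.ae_scoreEnergy_le_logNormalizer hβ hκ hα hadapt] with ω ⟨C, hC⟩
      obtain ⟨C', hC'1, hC'⟩ := exists_leverageSum_le_log_energy hα 0 q
        (ybProc a b u w η ω) (ubProc u ξ ω)
      refine ⟨|C| * (C' * (2 + Real.log C') ^ κ), fun k => (hC (k + 1)).trans ?_⟩
      have hL := one_le_log_energy 0 q (ybProc a b u w η ω) (ubProc u ξ ω) k
      have h1 := hC' k
      rw [hreg] at h1
      have h2 := one_le_leverageSum hα (fun t => x t ω) (k + 1)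
      have h3 := logNormalizer_mono (κ := κ) (by linarith) h2 h1
      have h4 := logNormalizer_mul_le (κ := κ) (by linarith) hC'1 hL
      have h5 := logNormalizer_pos (κ := κ) h2
      rw [excitationRate, if_pos hβ2, mul_assoc |C|]
      exact mul_le_mul (le_abs_self C) (h3.trans h4) h5.le (abs_nonneg C)
    · have hβ' : 2 < β := lt_of_le_of_ne hβ (Ne.symm hβ2)
      filter_upwards [hmart.ae_scoreEnergy_le hβ' hα hadapt] with ω ⟨C, hC⟩
      obtain ⟨C', hC'1, hC'⟩ := exists_leverageSum_le_log_energy hα 0 q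
        (ybProc a b u w η ω) (ubProc u ξ ω)
      refine ⟨|C| * C', fun k => (hC (k + 1)).trans ?_⟩
      have h1 := hC' k
      rw [hreg] at h1
      have h2 := one_le_leverageSum hα (fun t => x t ω) (k + 1)
      rw [excitationRate, if_neg hβ2, mul_assoc]
      exact mul_le_mul (le_abs_self C) h1 (by linarith) (abs_nonneg C)
  have hxη : ∀ t, Measurable[noiseFiltration hu hw hη t] (x t) := fun t => by
    refine @measurable_pi_lambda _ _ _ (noiseFiltration hu hw hη t) _ _ fun s => ?_
    rcases s with j | s
    · exact j.elim0
    · exact measurable_noiseFiltration_of_drivers hu hw hη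
        ((measurable_lag s.1 t s.2).comp measurable_fst) t
  have hη4 := (boundedMartingaleNoise_laplace hindep hu hw hη hξm hb₀ hLap).ae_scoreEnergy_le
    (by norm_num) hα hxη
  filter_upwards [hbound, hη4, hexc, hmin] with ω ⟨C₁, h1⟩ ⟨C₂, h2⟩ hexc hmin
  set yb := ybProc a b u w η ω with hyb
  set ub := ubProc u ξ ω with hub
  set e : ℕ → Idx 0 q → ℝ := fun k => estimate α θ₀ yb ub k - paramVec a b
  set z : Idx 0 q → ℝ := α • (θ₀ - paramVec a b)
  set v : ℕ → ℝ := fun t => w t ω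
  set v' : ℕ → ℝ := fun t => η t ω
  obtain ⟨C', hC'1, hC'⟩ := exists_leverageSum_le_log_energy hα 0 q yb ub
  have herr : ∀ k, infoMatrix α (fun t => x t ω) k *ᵥ e k =
      z + score (fun t => x t ω) (v + v') k := fun k => by
    have := infoMatrix_mulVec_error hα θ₀ (paramVec a b) yb (v + v') ub (fun k => by
      rw [hreg]; exact ybProc_zero_order_succ a b u w η ω _ k) k
    rwa [hreg] at this
  have hfin : ∀ k, lambdaMin (gainInv α θ₀ yb ub (k + 1)) * (e (k + 1) ⬝ᵥ e (k + 1)) ≤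
      2 * (z ⬝ᵥ ((infoMatrix α (fun t => x t ω) 0)⁻¹ *ᵥ z)) +
        (4 * C₁ + 4 * (|C₂| * C')) * excitationRate β κ (energy 0 q yb ub k) := fun k => by
    have h3 := lambdaMin_mul_error_le hα (fun t => x t ω) v v' z (e (k + 1)) (k + 1)
      (herr (k + 1))
    rw [gainInv_eq hα, hreg]
    have h4 := hC' k
    rw [hreg] at h4
    have h5 := one_le_leverageSum hα (fun t => x t ω) (k + 1)
    have h6 := log_le_excitationRate (β := β) (κ := κ) (by linarith)
      (one_le_log_energy 0 q yb ub k)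
    have h7 : scoreEnergy α (fun t => x t ω) v' (k + 1) ≤
        |C₂| * C' * excitationRate β κ (energy 0 q yb ub k) := by
      refine (h2 (k + 1)).trans ?_
      rw [mul_assoc]
      refine mul_le_mul (le_abs_self C₂) (h4.trans ?_) (by linarith) (abs_nonneg C₂)
      exact mul_le_mul_of_nonneg_left h6 (by linarith)
    have h8 := h1 k
    linarith
  have hlim := tendsto_of_mul_dotProduct_le (e := fun k => e (k + 1))
    (hmin.comp (tendsto_add_atTop_nat 1)) hexc hfin
  have hlim' : Tendsto e atTop (𝓝 0) := (tendsto_add_atTop_iff_nat 1).1 hlim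
  have := hlim'.add_const (paramVec a b)
  simpa [e] using this
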